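/- **Setting.** Let $\mathcal X,\mathcal Y\subseteq\mathbb R^d$, let $\phi_X:\mathcal X\to H_X$, $\phi_Y:\mathcal Y\to H_Y$, $\phi_{XY}:\mathcal X\times\mathcal Y\to H_{XY}$ be maps into real inner product spaces (feature maps), with kernels $k_X(a,b)=\langle\phi_X(a),\phi_X(b)\rangle$, and $k_Y$, $k_{XY}$ defined likewise. Let $x_1,\dots,x_N\in\mathcal X$ and $y_1,\dots,y_N\in\mathcal Y$ be samples, $(\tilde x_1,\tilde y_1),\dots,(\tilde x_n,\tilde y_n)\in\mathcal X\times\mathcal Y$ filling points, and $\lambda_1,\lambda_2>0$. Put $Q_{ij}=k_X(\tilde x_i,\tilde x_j)+k_Y(\tilde y_i,\tilde y_j)$, $z_i=\frac1N\sum_j k_X(x_j,\tilde x_i)+\frac1N\sum_j k_Y(y_j,\tilde y_i)-\lambda_2\|\tilde x_i-\tilde y_i\|^2$, and let $\Phi_1,\dots,\Phi_n$ be the columns of an upper triangular matrix $U$ with $U^\top U=\big(k_{XY}((\tilde x_i,\tilde y_i),(\tilde x_j,\tilde y_j))\big)_{ij}$. Let $\Phi(X)=(\langle X,\Phi_i\Phi_i^\top\rangle)_{i}$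 and $\Phi^\star(\gamma)=\sum_i\gamma_i\Phi_i\Phi_i^\top$, let $\mathcal S^n_+$ be the cone of symmetric positive semidefinite $n\times n$ matrices, and let $\mathrm{proj}_{\mathcal S^n_+}$ be the metric projection in the Frobenius norm. For $w=(\gamma,X)\in\mathbb R^n\times\mathbb R^{n\times n}$ let $\|w\|=\|\gamma\|_2+\|X\|_F$ and $$R(w)=\Big(\tfrac1{2\lambda_2}Q\gamma-\tfrac1{2\lambda_2}z-\Phi(X),\; X-\mathrm{proj}_{\mathcal S^n_+}\big(X-(\Phi^\star(\gamma)+\lambda_1I)\big)\Big).$$ The Clarke generalized Jacobian $\partial R(w)$ is the convex hull of all limits of derivatives $R'(w^j)$ along sequences $w^j\to w$ of points of differentiability of $R$. **Algorithm.** Fix $0<\tau,\kappa<1$, $\alpha_2\ge\alpha_1>0$, $0<\beta_0<1$, $\beta_1>0$, $\beta_2>1$, $\underline\theta,\overline\theta,\theta_0>0$ and a step size $0<\eta<1/L$, where $L$ is a Lipschitz constant, in the Euclidean norm $(\|\gamma\|_2^2+\|X\|_F^2)^{1/2}$ and on $\mathbb R^n\times\mathcal S^n_+$, of $F(\gamma,X)=\big(\frac1{2\lambda_2}Q\gamma-\frac1{2\lambda_2}z-\Phi(X),\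 \Phi^\star(\gamma)+\lambda_1I\big)$. Start from $v_0=w_0\in\mathbb R^n\times\mathcal S^n_+$. For $k=0,1,2,\dots$: (i) do an extragradient step $v_{k+1}=\Pi\big(v_k-\eta F(\Pi(v_k-\eta F(v_k)))\big)$, where $\Pi$ is the projection onto $\mathbb R^n\times\mathcal S^n_+$; (ii) choose any $\mathcal J_k\in\partial R(w_k)$ and any $\Delta w_k$ with $\|(\mathcal J_k+\mu_k\mathcal I)[\Delta w_k]+R(w_k)\|\le\tau\min\{1,\kappa\|R(w_k)\|\|\Delta w_k\|\}$, where $\mu_k=\theta_k\|R(w_k)\|$, and put $\tilde w_{k+1}=w_k+\Delta w_k$; (iii) with $\rho_k=-\langle R(\tilde w_{k+1}),\Delta w_k\rangle$, let $\theta_{k+1}=\max\{\underline\theta,\beta_0\theta_k\}$ if $\rho_k\ge\alpha_2\|\Delta w_k\|^2$, $\theta_{k+1}=\beta_1\theta_k$ if $\alpha_1\|\Delta w_k\|^2\le\rho_k<\alpha_2\|\Delta w_k\|^2$, and $\theta_{k+1}=\min\{\overline\theta,\beta_2\theta_k\}$ otherwise; (iv) let $w_{k+1}=\tilde w_{k+1}$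 if $\|R(\tilde w_{k+1})\|\le\|R(v_{k+1})\|$, and $w_{k+1}=v_{k+1}$ otherwise. **Theorem.** Let $R(w^\star)=0$ and suppose that every element of $\partial R(w^\star)$ is invertible. Then there are $\varepsilon>0$ and $C>0$ such that every sequence $\{w_k\}_{k\ge0}$ generated by the algorithm from an initial point with $\|w_0-w^\star\|<\varepsilon$ satisfies $$\|R(w_{k+1})\|\le C\|R(w_k)\|^2\quad\text{for all }k\ge0,\qquad\text{and}\qquad \|R(w_k)\|\to0.$$ -/

import Mathlib

open Filter Topology
open scoped Matrix

noncomputable section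

namespace KernelOT

/-! ### Generalized Jacobians -/

section Clarke

variable {E F : Type*} [NormedAddCommGroup E] [NormedSpace ℝ E]
  [NormedAddCommGroup F] [NormedSpace ℝ F]

/-- The B-subdifferential of `f` at `x`: all limits of Fréchet derivatives of `f` along sequences of
points of differentiability that converge to `x`. -/
def bSubdifferential (f : E → F) (x : E) : Set (E →L[ℝ] F) :=
  {J | ∃ u : ℕ → E, (∀ k, DifferentiableAt ℝ f (u k)) ∧ Tendsto u atTop (𝓝 x) ∧
    Tendsto (fun k => fderiv ℝ f (u k)) atTop (𝓝 J)}

/-- The Clarke generalized Jacobian: the convex hull of the B-subdifferential. -/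
def clarkeJacobian (f : E → F) (x : E) : Set (E →L[ℝ] F) :=
  convexHull ℝ (bSubdifferential f x)

end Clarke

/-! ### Vector-matrix pairs -/

/-- Real `n × n` matrices with the Frobenius norm and inner product, that is, the Euclidean space
over the index pairs. -/
abbrev FrobMat (n : ℕ) := EuclideanSpace ℝ (Fin n × Fin n)

/-- Vector-matrix pairs `w = (γ, X)`. Mathlib's norm on the product is the maximum of the two norms;
it is only used for limits and Fréchet derivatives, which are the same for all equivalent norms. The
norm in the algorithm is `pairNorm`. -/
abbrev Pair (n : ℕ) := EuclideanSpace ℝ (Fin n) × FrobMat n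

variable {n : ℕ}

/-- An element of `FrobMat n` as a matrix. -/
def toMat (X : FrobMat n) : Matrix (Fin n) (Fin n) ℝ := Matrix.of fun i j => X (i, j)

/-- A matrix as an element of `FrobMat n`. -/
def ofMat (M : Matrix (Fin n) (Fin n) ℝ) : FrobMat n := WithLp.toLp 2 fun q => M q.1 q.2

/-- The norm `‖w‖ = ‖γ‖₂ + ‖X‖_F` of a vector-matrix pair. -/
def pairNorm (w : Pair n) : ℝ := ‖w.1‖ + ‖w.2‖

/-- The inner product of two vector-matrix pairs. -/
def pairInner (w w' : Pair n) : ℝ := inner ℝ w.1 w'.1 + inner ℝ w.2 w'.2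

/-- The Euclidean norm of a vector-matrix pair. -/
def pairEuclNorm (w : Pair n) : ℝ := √(pairInner w w)

/-- The inner product on `FrobMat n` is the Frobenius inner product `tr(Xᵀ Y)`. -/
theorem inner_frobMat (X Y : FrobMat n) :
    inner ℝ X Y = ((toMat X)ᵀ * toMat Y).trace := by
  simp only [PiLp.inner_apply, Fintype.sum_prod_type, Matrix.trace, Matrix.diag, Matrix.mul_apply,
    Matrix.transpose_apply, toMat, Matrix.of_apply]
  rw [Finset.sum_comm]
  simp [mul_comm]

/-- Every matrix has exactly one nearest point, in the Frobenius norm, in the cone of symmetric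
positive semidefinite matrices. -/
theorem existsUnique_nearest_psd (Z : FrobMat n) :
    ∃! P : FrobMat n, (toMat P).PosSemidef ∧
      ∀ S : FrobMat n, (toMat S).PosSemidef → ‖Z - P‖ ≤ ‖Z - S‖ := by
  have hcont : Continuous (toMat : FrobMat n → Matrix (Fin n) (Fin n) ℝ) := by
    refine continuous_matrix fun i j => ?_
    simp only [toMat, Matrix.of_apply]
    fun_prop
  have hcl : IsClosed {P : FrobMat n | (toMat P).PosSemidef} := by
    have : {P : FrobMat n | (toMat P).PosSemidef} = {P | (toMat P)ᴴ = toMat P} ∩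
        ⋂ x : Fin n → ℝ, {P | 0 ≤ star x ⬝ᵥ (toMat P *ᵥ x)} := by
      ext P
      simp [Matrix.posSemidef_iff_dotProduct_mulVec, Matrix.IsHermitian]
    rw [this]
    refine IsClosed.inter (isClosed_eq (by fun_prop) (by fun_prop)) (isClosed_iInter fun x => ?_)
    exact isClosed_le continuous_const (by fun_prop)
  have hzero : (toMat (0 : FrobMat n)).PosSemidef := by
    have h : toMat (0 : FrobMat n) = 0 := by ext i j; simp [toMat]
    rw [h]
    exact Matrix.PosSemidef.zero
  obtain ⟨P, hP, hd⟩ := hcl.exists_infDist_eq_dist ⟨0, hzero⟩ Z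
  have hmin : ∀ S : FrobMat n, (toMat S).PosSemidef → ‖Z - P‖ ≤ ‖Z - S‖ := fun S hS => by
    rw [← dist_eq_norm, ← dist_eq_norm, ← hd]
    exact Metric.infDist_le_dist_of_mem hS
  refine ⟨P, ⟨hP, hmin⟩, ?_⟩
  rintro P' ⟨hP', hmin'⟩
  have hM : (toMat ((1 / 2 : ℝ) • (P + P'))).PosSemidef := by
    have h : toMat ((1 / 2 : ℝ) • (P + P')) = (1 / 2 : ℝ) • (toMat P + toMat P') := by
      ext i j
      simp [toMat, mul_add]
    rw [h]
    exact (hP.add hP').smul (by norm_num)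
  have h1 := hmin _ hM
  have h2 := hmin' _ hM
  have h3 := parallelogram_law_with_norm ℝ (Z - P) (Z - P')
  have h4 : Z - P + (Z - P') = (2 : ℝ) • (Z - (1 / 2 : ℝ) • (P + P')) := by
    module
  have h5 : Z - P - (Z - P') = P' - P := by abel
  rw [h4, h5, norm_smul, Real.norm_ofNat] at h3
  have h6 : ‖P' - P‖ = 0 := by
    nlinarith [norm_nonneg (P' - P), norm_nonneg (Z - P), norm_nonneg (Z - P')]
  exact sub_eq_zero.mp (norm_eq_zero.mp h6)

/-- The metric projection onto the cone of symmetric positive semidefinite matrices, with respect to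
the Frobenius norm. -/
def projPSD (Z : FrobMat n) : FrobMat n := (existsUnique_nearest_psd Z).choose

/-- The set of pairs `(γ, X)` with `X` symmetric positive semidefinite. -/
def domain (n : ℕ) : Set (Pair n) := {w | (toMat w.2).PosSemidef}

/-- The projection onto the pairs `(γ, X)` with `X` symmetric positive semidefinite. -/
def projDomain (w : Pair n) : Pair n := (w.1, projPSD w.2)

/-! ### The kernel-based optimal transport problem -/

/-- The data of a kernel-based optimal transport problem on the domains `𝒳, 𝒴 ⊆ ℝ^d`: feature maps
into inner product spaces, `N` samples of each measure, `n` filling points, two regularization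
parameters, and an upper triangular Cholesky factor of the kernel matrix of the filling points. -/
structure Data (d n N : ℕ) (𝒳 𝒴 : Set (EuclideanSpace ℝ (Fin d))) (HX HY HXY : Type*)
    [NormedAddCommGroup HX] [InnerProductSpace ℝ HX]
    [NormedAddCommGroup HY] [InnerProductSpace ℝ HY]
    [NormedAddCommGroup HXY] [InnerProductSpace ℝ HXY] where
  φX : 𝒳 → HX
  φY : 𝒴 → HY
  φXY : 𝒳 × 𝒴 → HXY
  /-- the samples -/
  x : Fin N → 𝒳
  y : Fin N → 𝒴
  /-- the filling points -/
  xt : Fin n → 𝒳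
  yt : Fin n → 𝒴
  lam₁ : ℝ
  lam₂ : ℝ
  lam₁_pos : 0 < lam₁
  lam₂_pos : 0 < lam₂
  /-- the Cholesky factor; its `i`-th column is the vector `Φ_i` -/
  U : Matrix (Fin n) (Fin n) ℝ
  U_upper : ∀ i j, j < i → U i j = 0
  U_chol : Uᵀ * U =
    Matrix.of fun i j => (inner ℝ (φXY (xt i, yt i)) (φXY (xt j, yt j)) : ℝ)

namespace Data

variable {d n N : ℕ} {𝒳 𝒴 : Set (EuclideanSpace ℝ (Fin d))} {HX HY HXY : Type*}
  [NormedAddCommGroup HX] [InnerProductSpace ℝ HX]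
  [NormedAddCommGroup HY] [InnerProductSpace ℝ HY]
  [NormedAddCommGroup HXY] [InnerProductSpace ℝ HXY]
  (D : Data d n N 𝒳 𝒴 HX HY HXY)

/-- The kernel `k_X`. -/
def kX (a b : 𝒳) : ℝ := inner ℝ (D.φX a) (D.φX b)

/-- The kernel `k_Y`. -/
def kY (a b : 𝒴) : ℝ := inner ℝ (D.φY a) (D.φY b)

/-- `Q_ij = k_X(x̃_i, x̃_j) + k_Y(ỹ_i, ỹ_j)`. -/
def Q : Matrix (Fin n) (Fin n) ℝ := Matrix.of fun i j => D.kX (D.xt i) (D.xt j) + D.kY (D.yt i) (D.yt j)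

/-- `z_i = (1/N) ∑_j k_X(x_j, x̃_i) + (1/N) ∑_j k_Y(y_j, ỹ_i) - λ₂ ‖x̃_i - ỹ_i‖²`. -/
def z : EuclideanSpace ℝ (Fin n) := WithLp.toLp 2 fun i =>
  (1 / (N : ℝ)) * ∑ j, D.kX (D.x j) (D.xt i) + (1 / (N : ℝ)) * ∑ j, D.kY (D.y j) (D.yt i)
    - D.lam₂ * ‖(D.xt i : EuclideanSpace ℝ (Fin d)) - (D.yt i : EuclideanSpace ℝ (Fin d))‖ ^ 2

/-- The rank-one matrix `Φ_i Φ_iᵀ`. -/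
def rankOne (i : Fin n) : FrobMat n := ofMat (Matrix.vecMulVec (D.U.col i) (D.U.col i))

/-- The operator `Φ(X) = (⟨X, Φ_i Φ_iᵀ⟩)_i`. -/
def Phi (X : FrobMat n) : EuclideanSpace ℝ (Fin n) :=
  WithLp.toLp 2 fun i => inner ℝ X (D.rankOne i)

/-- The adjoint operator `Φ⋆(γ) = ∑_i γ_i Φ_i Φ_iᵀ`. -/
def PhiStar (γ : EuclideanSpace ℝ (Fin n)) : FrobMat n := ∑ i, γ i • D.rankOne i

/-- `Φ⋆(γ) + λ₁ I`. -/
def slack (γ : EuclideanSpace ℝ (Fin n)) : FrobMat n := D.PhiStar γ + D.lam₁ • ofMat 1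

/-- `(1/(2λ₂)) Q γ - (1/(2λ₂)) z - Φ(X)`. -/
def gradGamma (w : Pair n) : EuclideanSpace ℝ (Fin n) :=
  (1 / (2 * D.lam₂)) • (WithLp.toLp 2 (D.Q *ᵥ w.1.ofLp) : EuclideanSpace ℝ (Fin n))
    - (1 / (2 * D.lam₂)) • D.z - D.Phi w.2

/-- The residual map `R`. -/
def R (w : Pair n) : Pair n :=
  (D.gradGamma w, w.2 - projPSD (w.2 - D.slack w.1))

/-- The monotone operator `(∇_γ f, -∇_X f)` of the min-max problem
`min_γ max_{X ⪰ 0} f(γ, X)` with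
`f(γ, X) = (1/(4λ₂)) γᵀQγ - (1/(2λ₂)) γᵀz + q²/(4λ₂) - ⟨X, Φ⋆(γ) + λ₁ I⟩`. -/
def saddleOp (w : Pair n) : Pair n := (D.gradGamma w, D.slack w.1)

/-- One step of the extragradient method with step size `η` for the min-max problem. -/
def egStep (η : ℝ) (v : Pair n) : Pair n :=
  projDomain (v - η • D.saddleOp (projDomain (v - η • D.saddleOp v)))

/-- The step sizes of the extragradient method: `0 < η < 1 / L`, where `L` is a Lipschitz constant
of the operator on the feasible set with respect to the Euclidean norm. -/
def IsEGStepSize (η : ℝ) : Prop :=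
  0 < η ∧ ∃ L : ℝ, 0 < L ∧ η < 1 / L ∧ ∀ w ∈ domain n, ∀ w' ∈ domain n,
    pairEuclNorm (D.saddleOp w - D.saddleOp w') ≤ L * pairEuclNorm (w - w')

end Data

/-! ### The algorithm -/

/-- The numerical parameters of the semismooth Newton method. -/
structure Params where
  τ : ℝ
  κ : ℝ
  α₁ : ℝ
  α₂ : ℝ
  β₀ : ℝ
  β₁ : ℝ
  β₂ : ℝ
  θlo : ℝ
  θhi : ℝ
  /-- the initial value of the regularization parameter -/
  θinit : ℝ
  τ_pos : 0 < τ
  τ_lt : τ < 1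
  κ_pos : 0 < κ
  κ_lt : κ < 1
  α₁_pos : 0 < α₁
  α₁_le : α₁ ≤ α₂
  β₀_pos : 0 < β₀
  β₀_lt : β₀ < 1
  β₁_pos : 0 < β₁
  β₂_gt : 1 < β₂
  θlo_pos : 0 < θlo
  θhi_pos : 0 < θhi
  θinit_pos : 0 < θinit

/-- The update of the regularization parameter, where `s = ‖Δw‖²`. -/
def Params.nextTheta (p : Params) (θ ρ s : ℝ) : ℝ :=
  open Classical in
  if p.α₂ * s ≤ ρ then max p.θlo (p.β₀ * θ)
  else if p.α₁ * s ≤ ρ then p.β₁ * θ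
  else min p.θhi (p.β₂ * θ)

section Algorithm

variable {d n N : ℕ} {𝒳 𝒴 : Set (EuclideanSpace ℝ (Fin d))} {HX HY HXY : Type*}
  [NormedAddCommGroup HX] [InnerProductSpace ℝ HX]
  [NormedAddCommGroup HY] [InnerProductSpace ℝ HY]
  [NormedAddCommGroup HXY] [InnerProductSpace ℝ HXY]

/-- A run of the safeguarded inexact regularized semismooth Newton method: iterates `w`, extragradient
iterates `v`, Newton directions `Δ`, generalized Jacobians `J` and parameters `θ`. -/
structure IsRun (D : Data d n N 𝒳 𝒴 HX HY HXY) (p : Params) (η : ℝ)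
    (w v Δ : ℕ → Pair n) (J : ℕ → Pair n →L[ℝ] Pair n) (θ : ℕ → ℝ) : Prop where
  init_mem : w 0 ∈ domain n
  init_v : v 0 = w 0
  init_θ : θ 0 = p.θinit
  step_v : ∀ k, v (k + 1) = D.egStep η (v k)
  jac_mem : ∀ k, J k ∈ clarkeJacobian D.R (w k)
  /-- the inexact solution of `(J_k + μ_k I) Δw_k = -R(w_k)` with `μ_k = θ_k ‖R(w_k)‖` -/
  newton : ∀ k, pairNorm (J k (Δ k) + (θ k * pairNorm (D.R (w k))) • Δ k + D.R (w k))
    ≤ p.τ * min 1 (p.κ * pairNorm (D.R (w k)) * pairNorm (Δ k))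
  step_θ : ∀ k, θ (k + 1) =
    p.nextTheta (θ k) (-pairInner (D.R (w k + Δ k)) (Δ k)) (pairNorm (Δ k) ^ 2)
  accept : ∀ k, pairNorm (D.R (w k + Δ k)) ≤ pairNorm (D.R (v (k + 1))) →
    w (k + 1) = w k + Δ k
  safeguard : ∀ k, pairNorm (D.R (v (k + 1))) < pairNorm (D.R (w k + Δ k)) →
    w (k + 1) = v (k + 1)

/-- `w` is a sequence of iterates generated by the algorithm. -/
def GeneratedBy (D : Data d n N 𝒳 𝒴 HX HY HXY) (p : Params) (η : ℝ) (w : ℕ → Pair n) : Prop :=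
  ∃ (v Δ : ℕ → Pair n) (J : ℕ → Pair n →L[ℝ] Pair n) (θ : ℕ → ℝ), IsRun D p η w v Δ J θ

end Algorithm

end KernelOT

end

noncomputable section

namespace KernelOT

/-! ### Clarke Jacobians of Lipschitz maps between finite-dimensional spaces -/

/-! Near `wstar` the trial point of the Newton step already contracts quadratically; the remaining
work is to keep every iterate and every parameter in the region where this holds.

Two facts give the local contraction. Elements of the Clarke Jacobian are uniformly bounded below
near a root where all of them are invertible (`exists_clarkeJacobian_bounded_below`: compactness and
upper semicontinuity). And `R` is strongly semismooth at its roots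
(`Data.exists_norm_R_sub_fderiv_le`), which reduces to the projection onto the semidefinite cone.
There homogeneity gives `P'(A) A = A₊`, so the error is `P'(A) A₀ - A₀₊`. In an eigenbasis of `A`
its entries are computed by differentiating `A₊ A₋ = 0`. Entries with a large eigenvalue are
controlled by the product of the increments of the two parts; entries with two small eigenvalues, by
the near orthogonality of their eigenvectors to the range of `A₀`.

Globally, the extragradient iterates never move away from a root in the Euclidean norm
(`Data.pairEuclNorm_egStep_sub_le`), so a safeguard step stays in the ball, and it is taken only
when its residual is below that of the Newton trial point. The parameter `θ` could grow only through
the factor `β₁`; near the root that branch is never reached, because `ρ` is of smaller order than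
`‖Δ‖²`. Hence `θ`, and with it the constant, stays bounded. -/

theorem sum_extend_zero {ι κ M : Type*} [Fintype ι] [Fintype κ] [AddCommMonoid M] (e : ι ↪ κ)
    (g : ι → M) : ∑ i, Function.extend e g 0 i = ∑ a, g a := by
  rw [← Finset.sum_subset (Finset.subset_univ (Finset.univ.map e))]
  · rw [Finset.sum_map]
    exact Finset.sum_congr rfl fun a _ => e.injective.extend_apply g 0 a
  · intro i _ hi
    rw [Function.extend_apply' _ _ _ (by simpa using hi)]
    rfl

/-- In finite dimensions the convex hull of a compact set is compact. -/
theorem isCompact_convexHull {E : Type*} [NormedAddCommGroup E] [NormedSpace ℝ E]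
    [FiniteDimensional ℝ E] {s : Set E} (hs : IsCompact s) : IsCompact (convexHull ℝ s) := by
  rcases s.eq_empty_or_nonempty with rfl | ⟨s₀, hs₀⟩
  · simp
  -- By Carathéodory, this many points suffice, so the hull is the continuous image of a compact
  -- set; shorter combinations are padded with zero weights.
  let m := Module.finrank ℝ E + 1
  have hK : IsCompact (stdSimplex ℝ (Fin m) ×ˢ (Set.univ.pi fun _ : Fin m => s)) :=
    (isCompact_stdSimplex ℝ (Fin m)).prod (isCompact_univ_pi fun _ => hs)
  have hcont : Continuous fun q : (Fin m → ℝ) × (Fin m → E) => ∑ i, q.1 i • q.2 i := by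
    fun_prop
  convert hK.image hcont using 1
  refine Set.Subset.antisymm (fun x hx => ?_) ?_
  · obtain ⟨ι, hι, z, w, hz, hind, hw, hw1, hwx⟩ := eq_pos_convex_span_of_mem_convexHull hx
    have hcard : Fintype.card ι ≤ Fintype.card (Fin m) := by
      rw [Fintype.card_fin]
      exact hind.card_le_finrank_succ.trans (Nat.succ_le_succ (Submodule.finrank_le _))
    obtain ⟨e⟩ := Function.Embedding.nonempty_of_card_le hcard
    refine ⟨(Function.extend e w 0, Function.extend e z fun _ => s₀), ⟨⟨fun i => ?_, ?_⟩, ?_⟩, ?_⟩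
    · by_cases h : ∃ a, e a = i
      · obtain ⟨a, rfl⟩ := h
        simp only [e.injective.extend_apply]
        exact (hw a).le
      · simp [Function.extend_apply' _ _ _ h]
    · exact (sum_extend_zero e w).trans hw1
    · intro i _
      by_cases h : ∃ a, e a = i
      · obtain ⟨a, rfl⟩ := h
        simp only [e.injective.extend_apply]
        exact hz ⟨a, rfl⟩
      · simpa [Function.extend_apply' _ _ _ h] using hs₀
    · rw [← hwx, ← sum_extend_zero e]
      refine Finset.sum_congr rfl fun i _ => ?_
      by_cases h : ∃ a, e a = i
      · obtain ⟨a, rfl⟩ := h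
        simp only [e.injective.extend_apply]
      · simp [Function.extend_apply' _ _ _ h]
  · rintro _ ⟨⟨a, z⟩, ⟨ha, hz⟩, rfl⟩
    exact (convex_convexHull ℝ s).sum_mem (fun i _ => ha.1 i) ha.2
      fun i _ => subset_convexHull ℝ s (hz i trivial)

section Clarke

variable {E F : Type*} [NormedAddCommGroup E] [NormedSpace ℝ E]
  [NormedAddCommGroup F] [NormedSpace ℝ F]

/-- The B-subdifferential is a section of the closure of the graph of the derivative. -/
theorem mem_bSubdifferential_iff {f : E → F} {x : E} {J : E →L[ℝ] F} :
    J ∈ bSubdifferential f x ↔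
      (x, J) ∈ closure {q : E × (E →L[ℝ] F) | DifferentiableAt ℝ f q.1 ∧ fderiv ℝ f q.1 = q.2} := by
  rw [mem_closure_iff_seq_limit]
  constructor
  · rintro ⟨u, hd, hu, hJ⟩
    exact ⟨fun k => (u k, fderiv ℝ f (u k)), fun k => ⟨hd k, rfl⟩, hu.prodMk_nhds hJ⟩
  · rintro ⟨q, hq, hlim⟩
    refine ⟨fun k => (q k).1, fun k => (hq k).1, hlim.fst_nhds, ?_⟩
    simpa only [fun k => (hq k).2] using hlim.snd_nhds

theorem isClosed_bSubdifferential (f : E → F) (x : E) : IsClosed (bSubdifferential f x) := by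
  have h : bSubdifferential f x = (fun J => (x, J)) ⁻¹'
      closure {q : E × (E →L[ℝ] F) | DifferentiableAt ℝ f q.1 ∧ fderiv ℝ f q.1 = q.2} := by
    ext J
    exact mem_bSubdifferential_iff
  rw [h]
  exact isClosed_closure.preimage (by fun_prop)

/-- A second-order estimate at the points of differentiability extends to the Clarke Jacobian. -/
theorem norm_sub_clarkeJacobian_apply_le {f : E → F} {x : E} {C : ℝ} (hf : Continuous f)
    (hC : ∀ u, DifferentiableAt ℝ f u →
      ‖f u - f x - fderiv ℝ f u (u - x)‖ ≤ C * ‖u - x‖ ^ 2)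
    (w : E) {J : E →L[ℝ] F} (hJ : J ∈ clarkeJacobian f w) :
    ‖f w - f x - J (w - x)‖ ≤ C * ‖w - x‖ ^ 2 := by
  -- With `w` fixed, the estimate is a convex condition on `J`, so it need only be checked for
  -- limits of derivatives.
  have hconv : Convex ℝ ((fun J : E →L[ℝ] F => J (w - x)) ⁻¹'
      Metric.closedBall (f w - f x) (C * ‖w - x‖ ^ 2)) :=
    (convex_closedBall _ _).is_linear_preimage ⟨fun _ _ => rfl, fun _ _ => rfl⟩
  have hmem := convexHull_min (s := bSubdifferential f w) ?_ hconv hJ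
  · rw [norm_sub_rev, ← dist_eq_norm]
    exact hmem
  · rintro J ⟨u, hd, hu, hJ⟩
    change dist _ _ ≤ _
    rw [dist_comm, dist_eq_norm]
    refine le_of_tendsto_of_tendsto' (b := atTop) ?_ ?_ fun k => hC (u k) (hd k)
    · have h1 : Tendsto (fun k => fderiv ℝ f (u k) (u k - x)) atTop (𝓝 (J (w - x))) :=
        ((isBoundedBilinearMap_apply (𝕜 := ℝ) (E := E) (F := F)).continuous.tendsto (J, w - x)).comp
          (hJ.prodMk_nhds (hu.sub_const x))
      exact ((((hf.tendsto w).comp hu).sub_const (f x)).sub h1).norm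
    · exact (((hu.sub_const x).norm.pow 2).const_mul C)

variable [FiniteDimensional ℝ E] [FiniteDimensional ℝ F] {f : E → F} {K : NNReal}

theorem isCompact_bSubdifferential (hf : LipschitzWith K f) (x : E) :
    IsCompact (bSubdifferential f x) := by
  have : ProperSpace (E →L[ℝ] F) := FiniteDimensional.proper ℝ _
  refine (isCompact_closedBall (0 : E →L[ℝ] F) K).of_isClosed_subset
    (isClosed_bSubdifferential f x) ?_
  rintro J ⟨u, -, -, hJ⟩
  exact Metric.isClosed_closedBall.mem_of_tendsto hJ
    (Eventually.of_forall fun k => by simpa using norm_fderiv_le_of_lipschitz ℝ hf)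

/-- Derivatives at points near `x` are close to the B-subdifferential at `x`. -/
theorem exists_fderiv_mem_thickening (hf : LipschitzWith K f) (x : E) {r : ℝ} (hr : 0 < r) :
    ∃ δ > 0, ∀ u, dist u x < δ → DifferentiableAt ℝ f u →
      fderiv ℝ f u ∈ Metric.thickening r (bSubdifferential f x) := by
  have : ProperSpace (E →L[ℝ] F) := FiniteDimensional.proper ℝ _
  by_contra! hcon
  -- The derivatives along a sequence of counterexamples are bounded by `K`; a cluster point lies in
  -- the B-subdifferential, a contradiction.
  choose u hu hd hnot using fun k : ℕ => hcon (1 / ((k : ℝ) + 1)) Nat.one_div_pos_of_nat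
  have hux : Tendsto u atTop (𝓝 x) := by
    rw [tendsto_iff_dist_tendsto_zero]
    exact squeeze_zero (fun _ => dist_nonneg) (fun k => (hu k).le)
      tendsto_one_div_add_atTop_nhds_zero_nat
  obtain ⟨J, -, φ, hφ, hJ⟩ := (isCompact_closedBall (0 : E →L[ℝ] F) K).tendsto_subseq
    (x := fun k => fderiv ℝ f (u k)) fun k => by simpa using norm_fderiv_le_of_lipschitz ℝ hf
  have hmem : J ∈ bSubdifferential f x :=
    ⟨fun k => u (φ k), fun k => hd _, hux.comp hφ.tendsto_atTop, hJ⟩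
  obtain ⟨k, hk⟩ := (hJ.eventually
    (Metric.isOpen_thickening.mem_nhds (Metric.self_subset_thickening hr _ hmem))).exists
  exact hnot _ hk

/-- Upper semicontinuity of the Clarke Jacobian. -/
theorem exists_clarkeJacobian_subset_cthickening (hf : LipschitzWith K f) (x : E) {r : ℝ}
    (hr : 0 < r) : ∃ δ > 0, ∀ w, dist w x < δ →
      clarkeJacobian f w ⊆ Metric.cthickening r (clarkeJacobian f x) := by
  obtain ⟨δ, hδ, h⟩ := exists_fderiv_mem_thickening hf x hr
  refine ⟨δ, hδ, fun w hw => convexHull_min ?_ ((convex_convexHull ℝ _).cthickening r)⟩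
  rintro J ⟨u, hd, hu, hJ⟩
  have hmem : J ∈ closure (Metric.thickening r (bSubdifferential f x)) :=
    mem_closure_of_tendsto hJ ((hu.eventually (Metric.isOpen_ball.mem_nhds
      (Metric.mem_ball.mpr hw))).mono fun k hk => h _ hk (hd k))
  exact Metric.cthickening_subset_of_subset r (subset_convexHull ℝ _)
    (Metric.closure_thickening_subset_cthickening _ _ hmem)

/-- If all elements of the Clarke Jacobian at `x` are injective, then the elements of the Clarke
Jacobians at nearby points are bounded below uniformly. -/
theorem exists_clarkeJacobian_bounded_below (hf : LipschitzWith K f) (x : E)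
    (hinj : ∀ J ∈ clarkeJacobian f x, Function.Injective J) :
    ∃ δ > 0, ∃ m > 0, ∀ w, dist w x < δ → ∀ J ∈ clarkeJacobian f w, ∀ h, m * ‖h‖ ≤ ‖J h‖ := by
  have hcomp : IsCompact (clarkeJacobian f x) :=
    isCompact_convexHull (isCompact_bSubdifferential hf x)
  have : ProperSpace E := FiniteDimensional.proper ℝ _
  obtain ⟨m, hm, hlow⟩ : ∃ m > 0, ∀ J ∈ clarkeJacobian f x, ∀ h, ‖h‖ = 1 → m ≤ ‖J h‖ := by
    have hprod : IsCompact (clarkeJacobian f x ×ˢ Metric.sphere (0 : E) 1) :=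
      hcomp.prod (isCompact_sphere 0 1)
    rcases (clarkeJacobian f x ×ˢ Metric.sphere (0 : E) 1).eq_empty_or_nonempty with he | hne
    · refine ⟨1, one_pos, fun J hJ h hh => ?_⟩
      have : (J, h) ∈ clarkeJacobian f x ×ˢ Metric.sphere (0 : E) 1 := ⟨hJ, by simpa using hh⟩
      simp [he] at this
    · obtain ⟨⟨J₀, h₀⟩, ⟨hJ₀, hh₀⟩, hmin⟩ := hprod.exists_isMinOn hne
        (f := fun q : (E →L[ℝ] F) × E => ‖q.1 q.2‖) (by fun_prop)
      refine ⟨‖J₀ h₀‖, norm_pos_iff.mpr fun h0 => ?_, fun J hJ h hh =>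
        hmin (show (J, h) ∈ _ from ⟨hJ, by simpa using hh⟩)⟩
      have : h₀ = 0 := hinj J₀ hJ₀ (by rw [h0, map_zero])
      simp [this] at hh₀
  -- A perturbation of operator norm at most `m / 2` costs half of the lower bound `m`.
  obtain ⟨δ, hδ, hsub⟩ := exists_clarkeJacobian_subset_cthickening hf x (half_pos hm)
  refine ⟨δ, hδ, m / 2, half_pos hm, fun w hw J hJ h => ?_⟩
  have hJ' := hsub w hw hJ
  rw [hcomp.cthickening_eq_biUnion_closedBall (half_pos hm).le] at hJ'
  obtain ⟨J₁, hJ₁, hdist⟩ := Set.mem_iUnion₂.mp hJ'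
  rw [Metric.mem_closedBall, dist_eq_norm] at hdist
  have h1 : m * ‖h‖ ≤ ‖J₁ h‖ := by
    rcases eq_or_ne h 0 with rfl | h0
    · simp
    have hpos := norm_pos_iff.mpr h0
    have := hlow J₁ hJ₁ (‖h‖⁻¹ • h) (by rw [norm_smul, norm_inv, norm_norm, inv_mul_cancel₀ hpos.ne'])
    rwa [map_smul, norm_smul, norm_inv, norm_norm, inv_mul_eq_div, le_div_iff₀ hpos] at this
  have h2 : ‖J h - J₁ h‖ ≤ m / 2 * ‖h‖ :=
    ((J - J₁).le_opNorm h).trans (mul_le_mul_of_nonneg_right hdist (norm_nonneg _))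
  have h3 := norm_sub_norm_le (J₁ h) (J h)
  rw [norm_sub_rev] at h3
  linarith

end Clarke

/-! ### Matrices as operators -/

section Operators

variable {n : ℕ}

/-- The action of matrices on vectors. -/
def act : FrobMat n →ₗ[ℝ] EuclideanSpace ℝ (Fin n) →ₗ[ℝ] EuclideanSpace ℝ (Fin n) :=
  LinearMap.mk₂ ℝ (fun X u => WithLp.toLp 2 fun i => ∑ j, X (i, j) * u j)
    (fun X Y u => by ext i; simp [add_mul, Finset.sum_add_distrib])
    (fun c X u => by ext i; simp [mul_assoc, Finset.mul_sum])
    (fun X u v => by ext i; simp [mul_add, Finset.sum_add_distrib])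
    (fun c X u => by ext i; simp [mul_left_comm, Finset.mul_sum])

theorem act_apply (X : FrobMat n) (u : EuclideanSpace ℝ (Fin n)) (i : Fin n) :
    act X u i = ∑ j, X (i, j) * u j := rfl

/-- The rank-one matrix `u vᵀ`. -/
def outer (u v : EuclideanSpace ℝ (Fin n)) : FrobMat n := WithLp.toLp 2 fun q => u q.1 * v q.2

theorem outer_apply (u v : EuclideanSpace ℝ (Fin n)) (q : Fin n × Fin n) :
    outer u v q = u q.1 * v q.2 := rfl

theorem inner_outer (X : FrobMat n) (u v : EuclideanSpace ℝ (Fin n)) :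
    inner ℝ X (outer v u) = inner ℝ (act X u) v := by
  simp only [PiLp.inner_apply, Fintype.sum_prod_type, outer_apply, act_apply, RCLike.inner_apply,
    conj_trivial, Finset.mul_sum]
  exact Finset.sum_congr rfl fun i _ => Finset.sum_congr rfl fun j _ => by ring

theorem act_outer (a b u : EuclideanSpace ℝ (Fin n)) : act (outer a b) u = inner ℝ b u • a := by
  ext i
  simp only [act_apply, outer_apply, PiLp.smul_apply, PiLp.inner_apply, RCLike.inner_apply,
    conj_trivial, smul_eq_mul, Finset.sum_mul]
  exact Finset.sum_congr rfl fun j _ => by ring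

theorem norm_outer (u v : EuclideanSpace ℝ (Fin n)) : ‖outer u v‖ = ‖u‖ * ‖v‖ := by
  have h : ‖outer u v‖ ^ 2 = (‖u‖ * ‖v‖) ^ 2 := by
    rw [← real_inner_self_eq_norm_sq, inner_outer, act_outer, real_inner_smul_left,
      real_inner_self_eq_norm_sq, real_inner_self_eq_norm_sq]
    ring
  exact (sq_eq_sq₀ (norm_nonneg _) (by positivity)).mp h

theorem norm_act_le (X : FrobMat n) (u : EuclideanSpace ℝ (Fin n)) : ‖act X u‖ ≤ ‖X‖ * ‖u‖ := by
  have h : ‖act X u‖ * ‖act X u‖ ≤ ‖X‖ * ‖u‖ * ‖act X u‖ := by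
    rw [← real_inner_self_eq_norm_mul_norm, ← inner_outer]
    refine (real_inner_le_norm _ _).trans_eq ?_
    rw [norm_outer]
    ring
  rcases (norm_nonneg (act X u)).eq_or_lt with h0 | h0
  · rw [← h0]; positivity
  · exact le_of_mul_le_mul_right h h0

theorem act_injective : Function.Injective (act : FrobMat n → _) := by
  intro X Y h
  ext ⟨i, j⟩
  have := congrArg (fun w : EuclideanSpace ℝ (Fin n) => w i)
    (LinearMap.congr_fun h (EuclideanSpace.single j 1))
  simpa [act_apply] using this

/-- Allows matrix identities to be checked entrywise in an eigenbasis, where the projection and its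
derivative are explicit. -/
theorem ext_basis (q : OrthonormalBasis (Fin n) ℝ (EuclideanSpace ℝ (Fin n))) {X Y : FrobMat n}
    (h : ∀ i j, inner ℝ (act X (q i)) (q j) = inner ℝ (act Y (q i)) (q j)) : X = Y := by
  refine act_injective (q.toBasis.ext fun i => ?_)
  rw [q.coe_toBasis]
  exact InnerProductSpace.ext_inner_right_basis q.toBasis fun j => by rw [q.coe_toBasis]; exact h i j

/-- The norm of a matrix is controlled by its entries in an orthonormal basis. -/
theorem norm_le_of_entries (q : OrthonormalBasis (Fin n) ℝ (EuclideanSpace ℝ (Fin n)))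
    {X : FrobMat n} {c : ℝ} (h : ∀ i j, |inner ℝ (act X (q i)) (q j)| ≤ c) :
    ‖X‖ ≤ n ^ 2 * c := by
  have hX : X = ∑ i, ∑ j, (inner ℝ (act X (q i)) (q j) : ℝ) • outer (q j) (q i) := by
    refine ext_basis q fun i j => ?_
    simp [act_outer, sum_inner, real_inner_smul_left, q.inner_eq_ite]
  rw [hX]
  calc _ ≤ ∑ i : Fin n, ∑ j : Fin n, c := by
        refine (norm_sum_le _ _).trans (Finset.sum_le_sum fun i _ =>
          (norm_sum_le _ _).trans (Finset.sum_le_sum fun j _ => ?_))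
        rw [norm_smul, norm_outer, q.norm_eq_one, q.norm_eq_one, mul_one, mul_one]
        exact h i j
    _ = n ^ 2 * c := by simp; ring

/-- The transpose on `FrobMat n`. -/
def transp : FrobMat n →ₗ[ℝ] FrobMat n where
  toFun X := WithLp.toLp 2 fun q => X (q.2, q.1)
  map_add' X Y := by ext q; simp
  map_smul' c X := by ext q; simp

theorem transp_apply (X : FrobMat n) (i j : Fin n) : transp X (i, j) = X (j, i) := rfl

/-- The symmetric part of a matrix. -/
def symPart : FrobMat n →ₗ[ℝ] FrobMat n := (1 / 2 : ℝ) • (LinearMap.id + transp)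

theorem symPart_apply (X : FrobMat n) : symPart X = (1 / 2 : ℝ) • (X + transp X) := rfl

theorem inner_act_transp (X : FrobMat n) (u v : EuclideanSpace ℝ (Fin n)) :
    inner ℝ (act (transp X) u) v = inner ℝ u (act X v) := by
  simp only [PiLp.inner_apply, act_apply, RCLike.inner_apply, conj_trivial, Finset.mul_sum,
    Finset.sum_mul]
  rw [Finset.sum_comm]
  refine Finset.sum_congr rfl fun i _ => Finset.sum_congr rfl fun j _ => ?_
  rw [transp_apply]
  ring

theorem isSymmetric_act_iff {X : FrobMat n} : (act X).IsSymmetric ↔ transp X = X := by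
  constructor
  · intro h
    refine act_injective (LinearMap.ext fun u => ext_inner_right ℝ fun v => ?_)
    rw [inner_act_transp, h u v]
  · intro h u v
    rw [← inner_act_transp, h]

theorem inner_transp_left (X Y : FrobMat n) : inner ℝ (transp X) Y = inner ℝ X (transp Y) := by
  simp only [PiLp.inner_apply, Fintype.sum_prod_type]
  rw [Finset.sum_comm]
  rfl

theorem isSymmetric_act_symPart (X : FrobMat n) : (act (symPart X)).IsSymmetric := by
  rw [isSymmetric_act_iff]
  ext ⟨i, j⟩
  change (symPart X) (j, i) = _
  simp only [symPart_apply, PiLp.smul_apply, PiLp.add_apply]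
  change (1 / 2 : ℝ) • (X (j, i) + X (i, j)) = (1 / 2 : ℝ) • (X (i, j) + X (j, i))
  rw [add_comm]

theorem symPart_of_isSymmetric {X : FrobMat n} (h : (act X).IsSymmetric) : symPart X = X := by
  rw [symPart_apply, isSymmetric_act_iff.mp h]
  module

theorem inner_symPart_of_isSymmetric (X : FrobMat n) {Y : FrobMat n} (h : (act Y).IsSymmetric) :
    inner ℝ (symPart X) Y = inner ℝ X Y := by
  rw [symPart_apply, real_inner_smul_left, inner_add_left, inner_transp_left,
    isSymmetric_act_iff.mp h]
  ring

theorem norm_symPart_le (X : FrobMat n) : ‖symPart X‖ ≤ ‖X‖ := by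
  have h : ‖symPart X‖ * ‖symPart X‖ ≤ ‖X‖ * ‖symPart X‖ := by
    rw [← real_inner_self_eq_norm_mul_norm,
      inner_symPart_of_isSymmetric X (isSymmetric_act_symPart X)]
    exact real_inner_le_norm _ _
  rcases (norm_nonneg (symPart X)).eq_or_lt with h0 | h0
  · rw [← h0]; positivity
  · exact le_of_mul_le_mul_right h h0

theorem isSymmetric_act_sub {X Y : FrobMat n} (hX : (act X).IsSymmetric)
    (hY : (act Y).IsSymmetric) : (act (X - Y)).IsSymmetric := by
  rw [map_sub]
  exact hX.sub hY

theorem posSemidef_toMat_iff {X : FrobMat n} :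
    (toMat X).PosSemidef ↔ (act X).IsSymmetric ∧ ∀ u, 0 ≤ inner ℝ (act X u) u := by
  rw [Matrix.posSemidef_iff_dotProduct_mulVec, isSymmetric_act_iff]
  refine and_congr ⟨fun h => ?_, fun h => ?_⟩ ⟨fun h u => ?_, fun h x => ?_⟩
  · ext ⟨i, j⟩
    simpa [toMat, transp_apply] using congrFun (congrFun h i) j
  · ext i j
    simpa [toMat, transp_apply] using congrArg (fun Y : FrobMat n => Y (i, j)) h
  · have := h u.ofLp
    simpa [PiLp.inner_apply, dotProduct, Matrix.mulVec, toMat, act_apply] using this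
  · have := h (WithLp.toLp 2 x)
    simpa [PiLp.inner_apply, dotProduct, Matrix.mulVec, toMat, act_apply] using this

end Operators

/-! ### The projection onto the positive semidefinite cone -/

section Projection

variable {n : ℕ} (q : OrthonormalBasis (Fin n) ℝ (EuclideanSpace ℝ (Fin n)))

/-- The symmetric matrix with eigenvectors `q` and eigenvalues `c`. -/
def spectralMat (c : Fin n → ℝ) : FrobMat n := ∑ i, c i • outer (q i) (q i)

theorem act_spectralMat (c : Fin n → ℝ) (u : EuclideanSpace ℝ (Fin n)) :
    act (spectralMat q c) u = ∑ i, (c i * inner ℝ (q i) u) • q i := by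
  simp [spectralMat, act_outer, smul_smul]

theorem act_spectralMat_basis (c : Fin n → ℝ) (j : Fin n) :
    act (spectralMat q c) (q j) = c j • q j := by
  simp [act_spectralMat, q.inner_eq_ite]

theorem isSymmetric_act_spectralMat (c : Fin n → ℝ) : (act (spectralMat q c)).IsSymmetric := by
  intro u v
  simp only [act_spectralMat, sum_inner, inner_sum, real_inner_smul_left, real_inner_smul_right]
  exact Finset.sum_congr rfl fun i _ => by rw [real_inner_comm]; ring

theorem posSemidef_spectralMat {c : Fin n → ℝ} (hc : ∀ i, 0 ≤ c i) :
    (toMat (spectralMat q c)).PosSemidef := by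
  refine posSemidef_toMat_iff.mpr ⟨isSymmetric_act_spectralMat q c, fun u => ?_⟩
  simp only [act_spectralMat, sum_inner, real_inner_smul_left]
  exact Finset.sum_nonneg fun i _ => by
    rw [mul_assoc]; exact mul_nonneg (hc i) (mul_self_nonneg _)

theorem eq_spectralMat {A : FrobMat n} {c : Fin n → ℝ} (h : ∀ i, act A (q i) = c i • q i) :
    A = spectralMat q c :=
  ext_basis q fun i j => by rw [h, act_spectralMat_basis]

theorem inner_spectralMat (X : FrobMat n) (c : Fin n → ℝ) :
    inner ℝ X (spectralMat q c) = ∑ i, c i * inner ℝ (act X (q i)) (q i) := by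
  simp [spectralMat, inner_sum, real_inner_smul_right, inner_outer]

theorem exists_spectral {A : FrobMat n} (hA : (act A).IsSymmetric) :
    ∃ (q : OrthonormalBasis (Fin n) ℝ (EuclideanSpace ℝ (Fin n))) (c : Fin n → ℝ),
      A = spectralMat q c :=
  ⟨hA.eigenvectorBasis finrank_euclideanSpace_fin, hA.eigenvalues finrank_euclideanSpace_fin,
    eq_spectralMat _ fun i => by simp⟩

/-- The variational inequality of the truncation of the spectrum. -/
theorem inner_spectralMat_sub_nonneg {Z S : FrobMat n} {c : Fin n → ℝ}
    (hZ : symPart Z = spectralMat q c) (hS : (toMat S).PosSemidef) :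
    0 ≤ inner ℝ (Z - spectralMat q fun i => max (c i) 0)
      ((spectralMat q fun i => max (c i) 0) - S) := by
  obtain ⟨hS1, hS2⟩ := posSemidef_toMat_iff.mp hS
  have hsym := isSymmetric_act_spectralMat q fun i => max (c i) 0
  -- Only the symmetric part of the residual pairs with symmetric matrices, and it is minus the
  -- negative part of the spectrum.
  have hN : symPart (Z - spectralMat q fun i => max (c i) 0) =
      -spectralMat q fun i => max (-c i) 0 := by
    rw [map_sub, hZ, symPart_of_isSymmetric hsym]
    simp only [spectralMat, ← Finset.sum_sub_distrib, ← sub_smul, ← Finset.sum_neg_distrib,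
      ← neg_smul]
    refine Finset.sum_congr rfl fun i _ => ?_
    congr 1
    rcases le_total (c i) 0 with h | h <;> simp [h]
  rw [← inner_symPart_of_isSymmetric _ (isSymmetric_act_sub hsym hS1), hN, inner_neg_left,
    real_inner_comm, inner_spectralMat, ← Finset.sum_neg_distrib]
  refine Finset.sum_nonneg fun i _ => ?_
  rw [map_sub, LinearMap.sub_apply, act_spectralMat_basis, inner_sub_left, real_inner_smul_left,
    real_inner_self_eq_norm_sq, q.norm_eq_one]
  have := hS2 (q i)
  rcases le_total (c i) 0 with h | h
  · simp only [h, neg_nonneg, max_eq_right, max_eq_left]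
    nlinarith
  · simp [h]

/-- The projection truncates the spectrum of the symmetric part. -/
theorem projPSD_eq {Z : FrobMat n} {c : Fin n → ℝ} (hZ : symPart Z = spectralMat q c) :
    projPSD Z = spectralMat q fun i => max (c i) 0 := by
  refine (existsUnique_nearest_psd Z).unique (existsUnique_nearest_psd Z).choose_spec.1
    ⟨posSemidef_spectralMat q fun i => le_max_right _ _, fun S hS => ?_⟩
  have h := inner_spectralMat_sub_nonneg q hZ hS
  set P := spectralMat q fun i => max (c i) 0
  have h2 := norm_add_sq_real (Z - P) (P - S)
  rw [sub_add_sub_cancel] at h2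
  refine le_of_sq_le_sq ?_ (norm_nonneg _)
  nlinarith [sq_nonneg ‖P - S‖]

theorem posSemidef_projPSD (Z : FrobMat n) : (toMat (projPSD Z)).PosSemidef :=
  (existsUnique_nearest_psd Z).choose_spec.1.1

theorem isSymmetric_act_projPSD (Z : FrobMat n) : (act (projPSD Z)).IsSymmetric :=
  (posSemidef_toMat_iff.mp (posSemidef_projPSD Z)).1

theorem inner_sub_projPSD_nonneg (Z : FrobMat n) {S : FrobMat n} (hS : (toMat S).PosSemidef) :
    0 ≤ inner ℝ (Z - projPSD Z) (projPSD Z - S) := by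
  obtain ⟨q, c, h⟩ := exists_spectral (isSymmetric_act_symPart Z)
  rw [projPSD_eq q h]
  exact inner_spectralMat_sub_nonneg q h hS

/-- `R` is differentiated on all matrices, including nonsymmetric ones; this reduces them to the
symmetric case. -/
theorem projPSD_congr {Z Y : FrobMat n} (h : symPart Z = symPart Y) : projPSD Z = projPSD Y := by
  obtain ⟨q, c, hc⟩ := exists_spectral (isSymmetric_act_symPart Z)
  rw [projPSD_eq q hc, projPSD_eq q (h ▸ hc)]

/-- The projection is firmly nonexpansive. -/
theorem norm_projPSD_sub_sq_le (Z Y : FrobMat n) :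
    ‖projPSD Z - projPSD Y‖ ^ 2 ≤ inner ℝ (Z - Y) (projPSD Z - projPSD Y) := by
  have h1 := inner_sub_projPSD_nonneg Z (posSemidef_projPSD Y)
  have h2 := inner_sub_projPSD_nonneg Y (posSemidef_projPSD Z)
  rw [← real_inner_self_eq_norm_sq]
  simp only [inner_sub_left, inner_sub_right] at *
  have := real_inner_comm (projPSD Z) (projPSD Y)
  linarith

theorem norm_projPSD_sub_le (Z Y : FrobMat n) : ‖projPSD Z - projPSD Y‖ ≤ ‖Z - Y‖ := by
  have h1 := norm_projPSD_sub_sq_le Z Y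
  have h2 := real_inner_le_norm (Z - Y) (projPSD Z - projPSD Y)
  nlinarith [norm_nonneg (projPSD Z - projPSD Y), norm_nonneg (Z - Y)]

theorem norm_projPSD_sub_self_sub_le (Z Y : FrobMat n) :
    ‖(projPSD Z - Z) - (projPSD Y - Y)‖ ≤ ‖Z - Y‖ := by
  have h1 := norm_projPSD_sub_sq_le Z Y
  have h2 := norm_sub_sq_real (projPSD Z - projPSD Y) (Z - Y)
  rw [real_inner_comm] at h2
  have h3 : (projPSD Z - Z) - (projPSD Y - Y) = (projPSD Z - projPSD Y) - (Z - Y) := by abel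
  rw [h3]
  refine le_of_sq_le_sq ?_ (norm_nonneg _)
  nlinarith [sq_nonneg ‖projPSD Z - projPSD Y‖]

/-- The positive and the negative part of a symmetric matrix annihilate each other. -/
theorem inner_act_projPSD_eq_zero {A : FrobMat n} (hA : (act A).IsSymmetric)
    (u v : EuclideanSpace ℝ (Fin n)) :
    inner ℝ (act (projPSD A) u) (act (projPSD A - A) v) = 0 := by
  obtain ⟨q, c, hc⟩ := exists_spectral hA
  have hP := projPSD_eq q ((symPart_of_isSymmetric hA).trans hc)
  rw [isSymmetric_act_projPSD A u]
  convert inner_zero_right u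
  rw [← LinearMap.comp_apply]
  convert LinearMap.zero_apply v using 2
  refine q.toBasis.ext fun i => ?_
  rw [q.coe_toBasis, LinearMap.comp_apply, map_sub, LinearMap.sub_apply, hP,
    act_spectralMat_basis]
  rw [hc, act_spectralMat_basis, ← sub_smul, map_smul, act_spectralMat_basis, smul_smul]
  rcases le_total (c i) 0 with h | h <;> simp [h]

end Projection

/-! ### Derivatives of the projection -/

section Derivative

variable {n : ℕ} (q : OrthonormalBasis (Fin n) ℝ (EuclideanSpace ℝ (Fin n)))

theorem hasDerivAt_act_apply {g : ℝ → FrobMat n} {g' : FrobMat n} {t : ℝ} (hg : HasDerivAt g g' t)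
    (u : EuclideanSpace ℝ (Fin n)) : HasDerivAt (fun s => act (g s) u) (act g' u) t :=
  (act.flip u).toContinuousLinearMap.hasFDerivAt.comp_hasDerivAt t hg

/-- All values of the projection are symmetric, and this linear condition survives differentiation
along a line. -/
theorem isSymmetric_act_fderiv_projPSD {A : FrobMat n} {P' : FrobMat n →L[ℝ] FrobMat n}
    (hP : HasFDerivAt projPSD P' A) (B : FrobMat n) : (act (P' B)).IsSymmetric := by
  intro u v
  have hl : HasDerivAt (fun t : ℝ => projPSD (A + t • B)) (P' B) 0 := hP.hasLineDerivAt B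
  have h1 := (hasDerivAt_act_apply hl u).inner ℝ (hasDerivAt_const (0 : ℝ) v)
  have h2 := (hasDerivAt_const (0 : ℝ) u).inner ℝ (hasDerivAt_act_apply hl v)
  have h3 := h1.unique (h2.congr_of_eventuallyEq
    (Eventually.of_forall fun t => isSymmetric_act_projPSD _ u v))
  simpa using h3

/-- Differentiating `⟨A₊ u, A₋ v⟩ = 0` at `A = ∑ cᵢ qᵢ qᵢᵀ`. -/
theorem fderiv_projPSD_relation {A B : FrobMat n} {P' : FrobMat n →L[ℝ] FrobMat n}
    (hP : HasFDerivAt projPSD P' A) {c : Fin n → ℝ} (hA : A = spectralMat q c)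
    (hB : (act B).IsSymmetric) (i j : Fin n) :
    (max (c i) 0 + max (-c j) 0) * inner ℝ (act (P' B) (q i)) (q j) =
      max (c i) 0 * inner ℝ (act B (q i)) (q j) := by
  have hAs : (act A).IsSymmetric := hA ▸ isSymmetric_act_spectralMat q c
  have hPA : projPSD A = spectralMat q fun i => max (c i) 0 :=
    projPSD_eq q ((symPart_of_isSymmetric hAs).trans hA)
  have hl : HasDerivAt (fun t : ℝ => projPSD (A + t • B)) (P' B) 0 := hP.hasLineDerivAt B
  have hline : HasDerivAt (fun t : ℝ => A + t • B) B 0 := by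
    simpa using ((hasDerivAt_id (0 : ℝ)).smul_const B).const_add A
  have h1 := (hasDerivAt_act_apply hl (q i)).inner ℝ (hasDerivAt_act_apply (hl.sub hline) (q j))
  have h2 := h1.unique ((hasDerivAt_const (0 : ℝ) (0 : ℝ)).congr_of_eventuallyEq
    (Eventually.of_forall fun t => inner_act_projPSD_eq_zero
      (by rw [map_add, map_smul]; exact hAs.add (hB.smul (by simp))) (q i) (q j)))
  have hN : act (projPSD A - A) (q j) = max (-c j) 0 • q j := by
    rw [map_sub, LinearMap.sub_apply, hPA, hA, act_spectralMat_basis, act_spectralMat_basis,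
      ← sub_smul]
    congr 1
    rcases le_total (c j) 0 with h | h <;> simp [h]
  simp only [Pi.sub_apply, zero_smul, add_zero] at h2
  rw [hN, hPA, act_spectralMat_basis, real_inner_smul_left, real_inner_smul_right, map_sub,
    LinearMap.sub_apply, inner_sub_right, ← isSymmetric_act_fderiv_projPSD hP B,
    ← hB (q i)] at h2
  linarith

/-- The derivative of the projection in the eigenbasis. -/
theorem fderiv_projPSD_entry {A B : FrobMat n} {P' : FrobMat n →L[ℝ] FrobMat n}
    (hP : HasFDerivAt projPSD P' A) {c : Fin n → ℝ} (hA : A = spectralMat q c)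
    (hB : (act B).IsSymmetric) (i j : Fin n) :
    (|c i| + |c j|) * inner ℝ (act (P' B) (q i)) (q j) =
      (max (c i) 0 + max (c j) 0) * inner ℝ (act B (q i)) (q j) := by
  have h1 := fderiv_projPSD_relation q hP hA hB i j
  have h2 := fderiv_projPSD_relation q hP hA hB j i
  -- The relations for `(i, j)` and `(j, i)` concern the same entries; adding them turns the
  -- coefficients on the left into `|c i| + |c j|`.
  rw [isSymmetric_act_fderiv_projPSD hP B, real_inner_comm, hB (q j),
    real_inner_comm (act B (q i))] at h2
  rw [← max_zero_add_max_neg_zero_eq_abs_self, ← max_zero_add_max_neg_zero_eq_abs_self]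
  linarith

/-- The projection is not differentiable at singular matrices. -/
theorem ne_zero_of_differentiableAt_projPSD {A : FrobMat n} (hP : DifferentiableAt ℝ projPSD A)
    {c : Fin n → ℝ} (hA : A = spectralMat q c) (i : Fin n) : c i ≠ 0 := by
  intro hi
  -- Moving a zero eigenvalue through `t` exposes the kink of `max t 0`.
  have hform : ∀ t : ℝ, inner ℝ (act (projPSD (A + t • outer (q i) (q i))) (q i)) (q i) =
      max t 0 := by
    intro t
    have hs : A + t • outer (q i) (q i) = spectralMat q (c + Pi.single i t) := by
      refine eq_spectralMat q fun j => ?_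
      rw [hA, map_add, map_smul, LinearMap.add_apply, LinearMap.smul_apply,
        act_spectralMat_basis, act_outer, q.inner_eq_ite, Pi.add_apply, add_smul]
      rcases eq_or_ne i j with rfl | hij
      · simp
      · simp [hij]
    rw [projPSD_eq q ((symPart_of_isSymmetric (hs ▸ isSymmetric_act_spectralMat q _)).trans hs),
      act_spectralMat_basis, real_inner_smul_left, real_inner_self_eq_norm_sq, q.norm_eq_one]
    simp [hi]
  have hd := (hasDerivAt_act_apply (hP.hasFDerivAt.hasLineDerivAt (outer (q i) (q i))) (q i)).inner
    ℝ (hasDerivAt_const (0 : ℝ) (q i))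
  have hd' : DifferentiableAt ℝ (fun t : ℝ => max t 0) 0 :=
    (hd.congr_of_eventuallyEq (Eventually.of_forall fun t => (hform t).symm)).differentiableAt
  refine not_differentiableAt_abs_zero ?_
  have habs : (abs : ℝ → ℝ) = fun t => 2 * max t 0 - t := by
    ext t
    rcases le_total t 0 with h | h
    · simp [h, abs_of_nonpos]
    · rw [abs_of_nonneg h, max_eq_left h]; ring
  rw [habs]
  exact (hd'.const_mul 2).sub differentiableAt_id

/-- Homogeneity of the projection. -/
theorem fderiv_projPSD_self {A : FrobMat n} {P' : FrobMat n →L[ℝ] FrobMat n}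
    (hP : HasFDerivAt projPSD P' A) (hA : (act A).IsSymmetric) : P' A = projPSD A := by
  obtain ⟨q, c, hc⟩ := exists_spectral hA
  refine ext_basis q fun i j => ?_
  have h := fderiv_projPSD_entry q hP hc hA i j
  have h0 := ne_zero_of_differentiableAt_projPSD q hP.differentiableAt hc
  have hpos : |c i| + |c j| ≠ 0 := (add_pos (abs_pos.mpr (h0 i)) (abs_pos.mpr (h0 j))).ne'
  refine mul_left_cancel₀ hpos (h.trans ?_)
  rw [projPSD_eq q ((symPart_of_isSymmetric hA).trans hc), hc, act_spectralMat_basis,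
    act_spectralMat_basis, real_inner_smul_left, real_inner_smul_left, q.inner_eq_ite]
  rcases eq_or_ne i j with rfl | hij
  · rcases le_total (c i) 0 with h | h <;> simp [h, abs_of_nonneg]
  · simp [hij]

/-- A unit eigenvector of `A` is almost orthogonal to the eigenvectors of a nearby symmetric matrix
that belong to well-separated eigenvalues. -/
theorem abs_inner_eigenvector_le {A : FrobMat n} {b : Fin n → ℝ} {u : EuclideanSpace ℝ (Fin n)}
    (hu : ‖u‖ = 1) {x r : ℝ} (hAu : act A u = x • u) (k : Fin n) (hr : 0 < r)
    (hk : r ≤ |b k - x|) : |inner ℝ (q k) u| ≤ ‖A - spectralMat q b‖ / r := by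
  rw [le_div_iff₀ hr]
  have h1 : (b k - x) * inner ℝ (q k) u = -inner ℝ (q k) (act (A - spectralMat q b) u) := by
    rw [map_sub, LinearMap.sub_apply, hAu, inner_sub_right, real_inner_smul_right,
      ← isSymmetric_act_spectralMat q b, act_spectralMat_basis, real_inner_smul_left]
    ring
  have h2 : |inner ℝ (q k) (act (A - spectralMat q b) u)| ≤ ‖A - spectralMat q b‖ := by
    refine (abs_real_inner_le_norm _ _).trans ?_
    rw [q.norm_eq_one, one_mul]
    simpa [hu] using norm_act_le (A - spectralMat q b) u
  calc |inner ℝ (q k) u| * r ≤ |inner ℝ (q k) u| * |b k - x| :=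
        mul_le_mul_of_nonneg_left hk (abs_nonneg _)
    _ = |inner ℝ (q k) (act (A - spectralMat q b) u)| := by
        rw [mul_comm, ← abs_mul, h1, abs_neg]
    _ ≤ _ := h2

/-- Each nonzero eigenvalue contributes a product of two small components, so the bound is quadratic
in `s`. -/
theorem abs_inner_act_spectralMat_le {b : Fin n → ℝ} {u v : EuclideanSpace ℝ (Fin n)} {s : ℝ}
    (hu : ∀ k, b k ≠ 0 → |inner ℝ (q k) u| ≤ s) (hv : ∀ k, b k ≠ 0 → |inner ℝ (q k) v| ≤ s) :
    |inner ℝ (act (spectralMat q b) u) v| ≤ (∑ k, |b k|) * s ^ 2 := by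
  rw [act_spectralMat, sum_inner, Finset.sum_mul]
  refine (Finset.abs_sum_le_sum_abs _ _).trans (Finset.sum_le_sum fun k _ => ?_)
  rw [real_inner_smul_left, abs_mul, abs_mul, mul_assoc]
  rcases eq_or_ne (b k) 0 with h | h
  · simp [h]
  · refine mul_le_mul_of_nonneg_left ?_ (abs_nonneg _)
    rw [sq]
    exact mul_le_mul (hu k h) (hv k h) (abs_nonneg _) ((abs_nonneg _).trans (hu k h))

/-- Strong semismoothness of the projection at symmetric matrices, along symmetric matrices. -/
theorem exists_norm_projPSD_sub_fderiv_le_of_isSymmetric {A₀ : FrobMat n}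
    (hA₀ : (act A₀).IsSymmetric) :
    ∃ C : ℝ, 0 ≤ C ∧ ∀ (A : FrobMat n) (P' : FrobMat n →L[ℝ] FrobMat n), (act A).IsSymmetric →
      HasFDerivAt projPSD P' A →
      ‖projPSD A - projPSD A₀ - P' (A - A₀)‖ ≤ C * ‖A - A₀‖ ^ 2 := by
  obtain ⟨p, b, hb⟩ := exists_spectral hA₀
  -- The factor 2 keeps eigenvalues of `A` below `r` in modulus at distance at least `r` from the
  -- nonzero eigenvalues of `A₀`.
  obtain ⟨r, hr, hrb⟩ : ∃ r > 0, ∀ k, b k ≠ 0 → 2 * r ≤ |b k| := by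
    have : ∀ᶠ r in 𝓝[>] (0 : ℝ), ∀ k, b k ≠ 0 → 2 * r ≤ |b k| := by
      refine eventually_all.mpr fun k => ?_
      by_cases h : b k = 0
      · simp [h]
      · have hk : 0 < |b k| / 2 := half_pos (abs_pos.mpr h)
        filter_upwards [nhdsWithin_le_nhds (Iio_mem_nhds hk)] with r hr _
        have : r < |b k| / 2 := hr
        linarith
    obtain ⟨r, h1, h2⟩ := (this.and self_mem_nhdsWithin).exists
    exact ⟨r, h2, h1⟩
  have hP₀ : projPSD A₀ = spectralMat p fun i => max (b i) 0 :=
    projPSD_eq p ((symPart_of_isSymmetric hA₀).trans hb)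
  set S := ∑ k, |b k| with hS
  have hS0 : 0 ≤ S := Finset.sum_nonneg fun _ _ => abs_nonneg _
  -- The first term serves entries with `|c i|` or `|c j|` at least `r`, the second those with both
  -- below `r`.
  set C₀ := 2 / r + 2 * S / r ^ 2 with hC₀
  have hC₀0 : 0 ≤ C₀ := by positivity
  refine ⟨n ^ 2 * C₀, by positivity, fun A P' hA hP => ?_⟩
  obtain ⟨q, c, hc⟩ := exists_spectral hA
  have hPA : projPSD A = spectralMat q fun i => max (c i) 0 :=
    projPSD_eq q ((symPart_of_isSymmetric hA).trans hc)
  have h0 := ne_zero_of_differentiableAt_projPSD q hP.differentiableAt hc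
  set ε := ‖A - A₀‖ with hε
  have hrew : projPSD A - projPSD A₀ - P' (A - A₀) = P' A₀ - projPSD A₀ := by
    rw [map_sub, fderiv_projPSD_self hP hA]
    abel
  rw [hrew, mul_assoc]
  refine norm_le_of_entries q fun i j => ?_
  have hV := fderiv_projPSD_entry q hP hc hA₀ i j
  rw [map_sub, LinearMap.sub_apply, inner_sub_left]
  set v : ℝ := inner ℝ (act (P' A₀) (q i)) (q j) with hv
  set a : ℝ := inner ℝ (act A₀ (q i)) (q j) with ha
  set p₀ : ℝ := inner ℝ (act (projPSD A₀) (q i)) (q j) with hp₀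
  have hci := abs_pos.mpr (h0 i)
  have hcj := abs_pos.mpr (h0 j)
  by_cases hsmall : |c i| < r ∧ |c j| < r
  · have hcomp : ∀ l, |c l| < r → ∀ k, b k ≠ 0 → |inner ℝ (p k) (q l)| ≤ ε / r := by
      intro l hl k hk
      rw [hε, hb]
      refine abs_inner_eigenvector_le p (q.norm_eq_one l) (x := c l)
        (by rw [hc, act_spectralMat_basis]) k hr ?_
      have := abs_sub_abs_le_abs_sub (b k) (c l)
      linarith [hrb k hk]
    have h1 : |a| ≤ S * (ε / r) ^ 2 := by
      rw [ha, hb]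
      exact abs_inner_act_spectralMat_le p (hcomp i hsmall.1) (hcomp j hsmall.2)
    have h2 : |p₀| ≤ S * (ε / r) ^ 2 := by
      have hne : ∀ k, max (b k) 0 ≠ 0 → b k ≠ 0 := fun k h h' => h (by simp [h'])
      rw [hp₀, hP₀]
      refine (abs_inner_act_spectralMat_le p (fun k hk => hcomp i hsmall.1 k (hne k hk))
        (fun k hk => hcomp j hsmall.2 k (hne k hk))).trans
        (mul_le_mul_of_nonneg_right (Finset.sum_le_sum fun k _ => ?_) (sq_nonneg _))
      rw [abs_of_nonneg (le_max_right _ _)]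
      exact max_le (le_abs_self _) (abs_nonneg _)
    -- The multiplier of the entry, `(max (c i) 0 + max (c j) 0) / (|c i| + |c j|)`, is at most 1.
    have h3 : |v| ≤ |a| := by
      have h4 : (|c i| + |c j|) * |v| ≤ (|c i| + |c j|) * |a| := by
        have h5 := congrArg abs hV
        rw [abs_mul, abs_mul, abs_of_pos (add_pos hci hcj),
          abs_of_nonneg (add_nonneg (le_max_right (c i) 0) (le_max_right (c j) 0))] at h5
        rw [h5]
        exact mul_le_mul_of_nonneg_right (add_le_add (max_le (le_abs_self _) (abs_nonneg _))
          (max_le (le_abs_self _) (abs_nonneg _))) (abs_nonneg _)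
      exact le_of_mul_le_mul_left h4 (add_pos hci hcj)
    calc |v - p₀| ≤ |v| + |p₀| := abs_sub _ _
      _ ≤ S * (ε / r) ^ 2 + S * (ε / r) ^ 2 := by linarith
      _ = 2 * S / r ^ 2 * ε ^ 2 := by ring
      _ ≤ C₀ * ε ^ 2 := by
        refine mul_le_mul_of_nonneg_right ?_ (sq_nonneg _)
        rw [hC₀]
        have : 0 ≤ 2 / r := by positivity
        linarith
  -- Up to sign this is an entry of the product of the increments of the positive and negative
  -- parts: the pure terms vanish, and each increment has norm at most `ε`.
  · have hg : ∀ k l, |max (c k) 0 * (inner ℝ (act (projPSD A₀) (q k)) (q l)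
        - inner ℝ (act A₀ (q k)) (q l)) + max (-c l) 0 * inner ℝ (act (projPSD A₀) (q k)) (q l)|
        ≤ ε ^ 2 := by
      intro k l
      have hP1 : act (projPSD A) (q k) = max (c k) 0 • q k := by rw [hPA, act_spectralMat_basis]
      have hN1 : act (projPSD A - A) (q l) = max (-c l) 0 • q l := by
        rw [map_sub, LinearMap.sub_apply, hPA, hc, act_spectralMat_basis, act_spectralMat_basis,
          ← sub_smul]
        congr 1
        rcases le_total (c l) 0 with h | h <;> simp [h]
      have h1 : inner ℝ (act (projPSD A - projPSD A₀) (q k))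
          (act ((projPSD A - A) - (projPSD A₀ - A₀)) (q l)) =
          -(max (c k) 0 * (inner ℝ (act (projPSD A₀) (q k)) (q l)
        - inner ℝ (act A₀ (q k)) (q l)) +
            max (-c l) 0 * inner ℝ (act (projPSD A₀) (q k)) (q l)) := by
        rw [map_sub, map_sub act (projPSD A - A), LinearMap.sub_apply, LinearMap.sub_apply,
          inner_sub_left, inner_sub_right, inner_sub_right, inner_act_projPSD_eq_zero hA,
          inner_act_projPSD_eq_zero hA₀, hP1, hN1, real_inner_smul_left, real_inner_smul_right,
          map_sub, LinearMap.sub_apply, inner_sub_right, ← isSymmetric_act_projPSD A₀, ← hA₀ (q k)]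
        ring
      rw [← abs_neg, ← h1]
      refine (abs_real_inner_le_norm _ _).trans ?_
      have h2 := norm_act_le (projPSD A - projPSD A₀) (q k)
      have h3 := norm_act_le ((projPSD A - A) - (projPSD A₀ - A₀)) (q l)
      rw [q.norm_eq_one, mul_one] at h2 h3
      rw [sq]
      exact mul_le_mul (h2.trans (norm_projPSD_sub_le A A₀))
        (h3.trans (norm_projPSD_sub_self_sub_le A A₀)) (norm_nonneg _) (norm_nonneg _)
    have h1 := abs_le.mp (hg i j)
    have h2 := abs_le.mp (hg j i)
    rw [isSymmetric_act_projPSD A₀ (q j), real_inner_comm, hA₀ (q j),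
      real_inner_comm (act A₀ (q i))] at h2
    rw [← hp₀, ← ha] at h1 h2
    -- By `hV`, the quantity inside is minus the sum of the expressions bounded in `h1` and `h2`.
    have hsum : (|c i| + |c j|) * |v - p₀| ≤ 2 * ε ^ 2 := by
      rw [← abs_of_pos (add_pos hci hcj), ← abs_mul, abs_le, mul_sub, hV,
        ← max_zero_add_max_neg_zero_eq_abs_self, ← max_zero_add_max_neg_zero_eq_abs_self]
      constructor <;> linarith
    have hlarge : r ≤ |c i| + |c j| := by
      by_contra! h
      exact hsmall ⟨by linarith, by linarith⟩
    have h3 : r * |v - p₀| ≤ 2 * ε ^ 2 :=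
      (mul_le_mul_of_nonneg_right hlarge (abs_nonneg _)).trans hsum
    calc |v - p₀| ≤ 2 * ε ^ 2 / r := by rw [le_div_iff₀ hr]; linarith
      _ = 2 / r * ε ^ 2 := by ring
      _ ≤ C₀ * ε ^ 2 := by
        refine mul_le_mul_of_nonneg_right ?_ (sq_nonneg _)
        rw [hC₀]
        have : 0 ≤ 2 * S / r ^ 2 := by positivity
        linarith

/-- Strong semismoothness of the projection at symmetric matrices. -/
theorem exists_norm_projPSD_sub_fderiv_le {A₀ : FrobMat n} (hA₀ : (act A₀).IsSymmetric) :
    ∃ C : ℝ, 0 ≤ C ∧ ∀ (Z : FrobMat n) (P' : FrobMat n →L[ℝ] FrobMat n),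
      HasFDerivAt projPSD P' Z → ‖projPSD Z - projPSD A₀ - P' (Z - A₀)‖ ≤ C * ‖Z - A₀‖ ^ 2 := by
  obtain ⟨C, hC, h⟩ := exists_norm_projPSD_sub_fderiv_le_of_isSymmetric hA₀
  refine ⟨C, hC, fun Z P' hP => ?_⟩
  have hss : symPart (symPart Z) = symPart Z := symPart_of_isSymmetric (isSymmetric_act_symPart Z)
  have hk : symPart (Z - symPart Z) = 0 := by rw [map_sub, hss, sub_self]
  have hinv : ∀ (t : ℝ) (Y : FrobMat n), projPSD (Y + t • (Z - symPart Z)) = projPSD Y :=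
    fun t Y => projPSD_congr (by rw [map_add, map_smul, hk, smul_zero, add_zero])
  -- The projection is invariant under adding the antisymmetric part of `Z`, so its derivative is
  -- the same at `symPart Z` and kills that direction.
  have hP2 : HasFDerivAt projPSD P' (symPart Z) := by
    have h1 : HasFDerivAt projPSD P' (symPart Z + (Z - symPart Z)) := by
      rwa [add_sub_cancel]
    refine ((hasFDerivAt_comp_add_right _).mpr h1).congr_of_eventuallyEq (Eventually.of_forall fun Y => ?_)
    simpa using (hinv 1 Y).symm
  have hker : P' (Z - symPart Z) = 0 := by
    have h1 : HasDerivAt (fun t : ℝ => projPSD (Z + t • (Z - symPart Z))) (P' (Z - symPart Z)) 0 :=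
      hP.hasLineDerivAt _
    exact h1.unique ((hasDerivAt_const (0 : ℝ) (projPSD Z)).congr_of_eventuallyEq
      (Eventually.of_forall fun t => hinv t Z))
  have h1 := h _ P' (isSymmetric_act_symPart Z) hP2
  have h2 : P' (Z - A₀) = P' (symPart Z - A₀) := by
    rw [← sub_add_sub_cancel Z (symPart Z) A₀, map_add, hker, zero_add]
  have h3 : ‖symPart Z - A₀‖ ≤ ‖Z - A₀‖ := by
    rw [← symPart_of_isSymmetric hA₀, ← map_sub, symPart_of_isSymmetric hA₀]
    exact norm_symPart_le _
  rw [h2, projPSD_congr hss.symm]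
  exact h1.trans (by gcongr)

end Derivative

/-! ### Norms on vector-matrix pairs -/

section PairNorms

variable {n : ℕ}

theorem norm_le_pairNorm (w : Pair n) : ‖w‖ ≤ pairNorm w :=
  max_le (le_add_of_nonneg_right (norm_nonneg _)) (le_add_of_nonneg_left (norm_nonneg _))

theorem pairNorm_le (w : Pair n) : pairNorm w ≤ 2 * ‖w‖ := by
  have h1 := norm_fst_le w
  have h2 := norm_snd_le w
  rw [pairNorm]
  linarith

theorem pairNorm_nonneg (w : Pair n) : 0 ≤ pairNorm w := add_nonneg (norm_nonneg _) (norm_nonneg _)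

theorem pairInner_eq_inner_toLp (w w' : Pair n) :
    pairInner w w' = inner ℝ (WithLp.toLp 2 w) (WithLp.toLp 2 w') :=
  (WithLp.prod_inner_apply (WithLp.toLp 2 w) (WithLp.toLp 2 w')).symm

theorem pairEuclNorm_eq_norm_toLp (w : Pair n) : pairEuclNorm w = ‖WithLp.toLp 2 w‖ := by
  rw [norm_eq_sqrt_real_inner, pairEuclNorm, pairInner_eq_inner_toLp]

theorem pairEuclNorm_sq (w : Pair n) : pairEuclNorm w ^ 2 = ‖w.1‖ ^ 2 + ‖w.2‖ ^ 2 := by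
  rw [pairEuclNorm_eq_norm_toLp, ← real_inner_self_eq_norm_sq, ← pairInner_eq_inner_toLp, pairInner,
    real_inner_self_eq_norm_sq, real_inner_self_eq_norm_sq]

theorem norm_le_pairEuclNorm (w : Pair n) : ‖w‖ ≤ pairEuclNorm w := by
  have h := pairEuclNorm_sq w
  have h0 : 0 ≤ pairEuclNorm w := Real.sqrt_nonneg _
  refine max_le (le_of_sq_le_sq ?_ h0) (le_of_sq_le_sq ?_ h0)
  · linarith [sq_nonneg ‖w.2‖]
  · linarith [sq_nonneg ‖w.1‖]

theorem pairEuclNorm_le_pairNorm (w : Pair n) : pairEuclNorm w ≤ pairNorm w := by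
  refine le_of_sq_le_sq ?_ (pairNorm_nonneg w)
  rw [pairEuclNorm_sq, pairNorm]
  nlinarith [norm_nonneg w.1, norm_nonneg w.2]

theorem abs_pairInner_le (w w' : Pair n) : |pairInner w w'| ≤ pairNorm w * pairNorm w' := by
  have h1 := abs_real_inner_le_norm w.1 w'.1
  have h2 := abs_real_inner_le_norm w.2 w'.2
  refine (abs_add_le _ _).trans ?_
  rw [pairNorm, pairNorm]
  nlinarith [mul_nonneg (norm_nonneg w.1) (norm_nonneg w'.2),
    mul_nonneg (norm_nonneg w.2) (norm_nonneg w'.1)]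

theorem projDomain_mem_domain (w : Pair n) : projDomain w ∈ domain n := posSemidef_projPSD w.2

theorem pairInner_sub_projDomain_nonneg (w : Pair n) {s : Pair n} (hs : s ∈ domain n) :
    0 ≤ pairInner (w - projDomain w) (projDomain w - s) := by
  simpa [pairInner, projDomain] using inner_sub_projPSD_nonneg w.2 hs

end PairNorms

/-! ### The extragradient step -/

/-- The basic inequality of the extragradient method: a step from `v` through `y` to `v'`, where `g`
and `g'` are the values of the operator at `v` and `y`, does not increase the distance to a
solution `x`. -/
theorem norm_extragradient_sub_le {H : Type*} [NormedAddCommGroup H] [InnerProductSpace ℝ H]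
    {v y v' x g g' : H} {η L : ℝ} (hη : 0 ≤ η) (hL : η * L ≤ 1)
    (h₁ : 0 ≤ inner ℝ (v - η • g' - v') (v' - x)) (h₂ : 0 ≤ inner ℝ (v - η • g - y) (y - v'))
    (h₃ : 0 ≤ inner ℝ g' (y - x)) (hLip : ‖g' - g‖ ≤ L * ‖y - v‖) : ‖v' - x‖ ≤ ‖v - x‖ := by
  refine le_of_sq_le_sq ?_ (norm_nonneg _)
  have e1 := norm_add_sq_real (v - v') (v' - x)
  rw [sub_add_sub_cancel] at e1
  have e2 := norm_add_sq_real (v - y) (y - v')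
  rw [sub_add_sub_cancel] at e2
  have e3 : v - η • g' - v' = (v - v') - η • g' := by abel
  have e4 : v - η • g - y = (v - y) - η • g := by abel
  rw [e3, inner_sub_left, real_inner_smul_left] at h₁
  rw [e4, inner_sub_left, real_inner_smul_left] at h₂
  have e5 : inner ℝ g' (v' - x) = inner ℝ g' (y - x) - inner ℝ g' (y - v') := by
    rw [← inner_sub_right]
    congr 1
    abel
  have e6 : η * (inner ℝ g' (y - v') - inner ℝ g (y - v')) ≤ ‖v - y‖ * ‖y - v'‖ := by
    rw [← inner_sub_left]
    calc η * inner ℝ (g' - g) (y - v') ≤ η * (L * ‖y - v‖ * ‖y - v'‖) :=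
          mul_le_mul_of_nonneg_left ((real_inner_le_norm _ _).trans
            (mul_le_mul_of_nonneg_right hLip (norm_nonneg _))) hη
      _ = (η * L) * (‖v - y‖ * ‖y - v'‖) := by rw [norm_sub_rev y v]; ring
      _ ≤ 1 * (‖v - y‖ * ‖y - v'‖) := mul_le_mul_of_nonneg_right hL (by positivity)
      _ = _ := one_mul _
  rw [e5] at h₁
  -- The Lipschitz cross term is absorbed by `‖v - y‖ ^ 2 + ‖y - v'‖ ^ 2`.
  nlinarith [mul_nonneg hη h₃, sq_nonneg (‖v - y‖ - ‖y - v'‖)]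

namespace Data

variable {d n N : ℕ} {𝒳 𝒴 : Set (EuclideanSpace ℝ (Fin d))} {HX HY HXY : Type*}
  [NormedAddCommGroup HX] [InnerProductSpace ℝ HX]
  [NormedAddCommGroup HY] [InnerProductSpace ℝ HY]
  [NormedAddCommGroup HXY] [InnerProductSpace ℝ HXY]
  (D : Data d n N 𝒳 𝒴 HX HY HXY)

/-- `Φ` as a linear map. -/
def PhiLin : FrobMat n →ₗ[ℝ] EuclideanSpace ℝ (Fin n) where
  toFun := D.Phi
  map_add' X Y := by ext i; simp [Phi, inner_add_left]
  map_smul' c X := by ext i; simp [Phi, real_inner_smul_left]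

/-- `Φ⋆` as a linear map. -/
def PhiStarLin : EuclideanSpace ℝ (Fin n) →ₗ[ℝ] FrobMat n where
  toFun := D.PhiStar
  map_add' a b := by simp [PhiStar, add_smul, Finset.sum_add_distrib]
  map_smul' c a := by simp [PhiStar, mul_smul, Finset.smul_sum]

/-- The matrix `Q` as a linear map. -/
def QLin : EuclideanSpace ℝ (Fin n) →ₗ[ℝ] EuclideanSpace ℝ (Fin n) where
  toFun a := WithLp.toLp 2 (D.Q *ᵥ a.ofLp)
  map_add' a b := by ext i; simp [Matrix.mulVec_add]
  map_smul' c a := by ext i; simp [Matrix.mulVec_smul]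

/-- The linear part of `gradGamma`. -/
def gradLin : Pair n →ₗ[ℝ] EuclideanSpace ℝ (Fin n) :=
  (1 / (2 * D.lam₂)) • D.QLin ∘ₗ LinearMap.fst ℝ _ _ - D.PhiLin ∘ₗ LinearMap.snd ℝ _ _

/-- The linear part of the argument of the projection in `R`. -/
def argLin : Pair n →ₗ[ℝ] FrobMat n :=
  LinearMap.snd ℝ _ _ - D.PhiStarLin ∘ₗ LinearMap.fst ℝ _ _

theorem gradGamma_eq (w : Pair n) : D.gradGamma w = D.gradLin w - (1 / (2 * D.lam₂)) • D.z := by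
  change (1 / (2 * D.lam₂)) • D.QLin w.1 - _ - D.PhiLin w.2 =
    ((1 / (2 * D.lam₂)) • D.QLin w.1 - D.PhiLin w.2) - _
  abel

theorem gradGamma_sub (w w' : Pair n) : D.gradGamma w - D.gradGamma w' = D.gradLin (w - w') := by
  rw [gradGamma_eq, gradGamma_eq, map_sub]
  abel

theorem slack_sub (a b : EuclideanSpace ℝ (Fin n)) :
    D.slack a - D.slack b = D.PhiStarLin (a - b) := by
  rw [map_sub]
  exact add_sub_add_right_eq_sub _ _ _

theorem snd_sub_slack (w : Pair n) : w.2 - D.slack w.1 = D.argLin w - D.lam₁ • ofMat 1 := by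
  change w.2 - (D.PhiStarLin w.1 + _) = (w.2 - D.PhiStarLin w.1) - _
  abel

theorem inner_PhiStar (a : EuclideanSpace ℝ (Fin n)) (X : FrobMat n) :
    inner ℝ (D.PhiStarLin a) X = inner ℝ (D.PhiLin X) a := by
  change inner ℝ (D.PhiStar a) X = inner ℝ (D.Phi X) a
  rw [PhiStar, sum_inner, PiLp.inner_apply]
  refine Finset.sum_congr rfl fun i _ => ?_
  rw [real_inner_smul_left, real_inner_comm]
  rfl

/-- `Q` is a sum of two Gram matrices. -/
theorem inner_QLin_nonneg (a : EuclideanSpace ℝ (Fin n)) : 0 ≤ inner ℝ (D.QLin a) a := by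
  have h : inner ℝ (D.QLin a) a =
      inner ℝ (∑ i, a i • D.φX (D.xt i)) (∑ i, a i • D.φX (D.xt i)) +
      inner ℝ (∑ i, a i • D.φY (D.yt i)) (∑ i, a i • D.φY (D.yt i)) := by
    simp only [PiLp.inner_apply, QLin, LinearMap.coe_mk, AddHom.coe_mk, Matrix.mulVec, dotProduct,
      Q, Matrix.of_apply, kX, kY, sum_inner, inner_sum, real_inner_smul_left, real_inner_smul_right,
      RCLike.inner_apply, conj_trivial, Finset.mul_sum, ← Finset.sum_add_distrib]
    exact Finset.sum_congr rfl fun i _ => Finset.sum_congr rfl fun j _ => by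
      rw [real_inner_comm (D.φX (D.xt i)), real_inner_comm (D.φY (D.yt i))]
      ring
  rw [h]
  exact add_nonneg real_inner_self_nonneg real_inner_self_nonneg

/-- The saddle operator is monotone. -/
theorem pairInner_saddleOp_sub_nonneg (w w' : Pair n) :
    0 ≤ pairInner (D.saddleOp w - D.saddleOp w') (w - w') := by
  have h1 : (D.saddleOp w - D.saddleOp w').1 = D.gradLin (w - w') := D.gradGamma_sub w w'
  have h2 : (D.saddleOp w - D.saddleOp w').2 = D.PhiStarLin (w - w').1 := D.slack_sub w.1 w'.1
  rw [pairInner, h1, h2, inner_PhiStar]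
  change 0 ≤ inner ℝ ((1 / (2 * D.lam₂)) • D.QLin (w - w').1 - D.PhiLin (w - w').2) (w - w').1 + _
  -- The `Φ` and `Φ⋆` terms cancel by adjointness; only the quadratic form of `Q` remains.
  rw [inner_sub_left, real_inner_smul_left, sub_add_cancel]
  have := D.lam₂_pos
  exact mul_nonneg (by positivity) (D.inner_QLin_nonneg _)

theorem snd_eq_projPSD_of_root {x : Pair n} (hx : D.R x = 0) :
    projPSD (x.2 - D.slack x.1) = x.2 :=
  (sub_eq_zero.mp (congrArg Prod.snd hx)).symm

theorem mem_domain_of_root {x : Pair n} (hx : D.R x = 0) : x ∈ domain n := by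
  change (toMat x.2).PosSemidef
  rw [← D.snd_eq_projPSD_of_root hx]
  exact posSemidef_projPSD _

/-- Roots of `R` solve the variational inequality of the saddle operator. -/
theorem pairInner_saddleOp_root_nonneg {x y : Pair n} (hx : D.R x = 0) (hy : y ∈ domain n) :
    0 ≤ pairInner (D.saddleOp x) (y - x) := by
  have h1 : D.gradGamma x = 0 := congrArg Prod.fst hx
  have h2 := inner_sub_projPSD_nonneg (x.2 - D.slack x.1) hy
  rw [D.snd_eq_projPSD_of_root hx, sub_sub_cancel_left, ← inner_neg_neg, neg_neg, neg_sub] at h2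
  change 0 ≤ inner ℝ (D.gradGamma x) (y.1 - x.1) + inner ℝ (D.slack x.1) (y.2 - x.2)
  rwa [h1, inner_zero_left, zero_add]

theorem egStep_mem_domain (η : ℝ) (v : Pair n) : D.egStep η v ∈ domain n :=
  projDomain_mem_domain _

/-- The extragradient step does not increase the Euclidean distance to a root of `R`. -/
theorem pairEuclNorm_egStep_sub_le {η : ℝ} (hη : D.IsEGStepSize η) {x v : Pair n}
    (hx : D.R x = 0) (hv : v ∈ domain n) :
    pairEuclNorm (D.egStep η v - x) ≤ pairEuclNorm (v - x) := by
  obtain ⟨hη0, L, hL, hηL, hLip⟩ := hη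
  set y := projDomain (v - η • D.saddleOp v) with hy
  have hyd : y ∈ domain n := projDomain_mem_domain _
  have h₁ := pairInner_sub_projDomain_nonneg (v - η • D.saddleOp y) (D.mem_domain_of_root hx)
  have h₂ := pairInner_sub_projDomain_nonneg (v - η • D.saddleOp v) (D.egStep_mem_domain η v)
  have h₃ : 0 ≤ pairInner (D.saddleOp y) (y - x) := by
    have a := D.pairInner_saddleOp_sub_nonneg y x
    have b := D.pairInner_saddleOp_root_nonneg hx hyd
    rw [pairInner_eq_inner_toLp] at a b ⊢
    rw [WithLp.toLp_sub, inner_sub_left] at a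
    linarith
  have h₄ := hLip y hyd v hv
  rw [pairInner_eq_inner_toLp] at h₁ h₂ h₃
  rw [pairEuclNorm_eq_norm_toLp, pairEuclNorm_eq_norm_toLp] at h₄ ⊢
  simp only [WithLp.toLp_sub, WithLp.toLp_smul] at h₁ h₂ h₃ h₄ ⊢
  exact norm_extragradient_sub_le hη0.le ((lt_div_iff₀ hL).mp hηL).le h₁ h₂ h₃ h₄

/-! ### Regularity of the residual map -/

theorem lipschitzWith_projPSD : LipschitzWith 1 (projPSD : FrobMat n → FrobMat n) :=
  LipschitzWith.of_dist_le_mul fun Z Y => by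
    simpa [dist_eq_norm] using norm_projPSD_sub_le Z Y

theorem exists_lipschitzWith_R : ∃ K : NNReal, LipschitzWith K D.R := by
  have hg := D.gradLin.toContinuousLinearMap.lipschitz.sub
    (LipschitzWith.const ((1 / (2 * D.lam₂)) • D.z))
  have ha := D.argLin.toContinuousLinearMap.lipschitz.sub
    (LipschitzWith.const (D.lam₁ • ofMat (1 : Matrix (Fin n) (Fin n) ℝ)))
  have hR : D.R = fun w => (D.gradLin w - (1 / (2 * D.lam₂)) • D.z,
      w.2 - projPSD (D.argLin w - D.lam₁ • ofMat 1)) := by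
    funext w
    rw [R, gradGamma_eq, snd_sub_slack]
  rw [hR]
  exact ⟨_, hg.prodMk (LipschitzWith.prod_snd.sub (lipschitzWith_projPSD.comp ha))⟩

/-- Where `R` is differentiable, so is the projection it contains. -/
theorem differentiableAt_projPSD_of_R {w : Pair n} (h : DifferentiableAt ℝ D.R w) :
    DifferentiableAt ℝ projPSD (w.2 - D.slack w.1) := by
  -- Fixing `γ` and shifting `X` recovers the projection from the second component of `R`.
  have hR : (projPSD : FrobMat n → FrobMat n) = fun Y =>
      (Y + D.slack w.1) - (D.R (w.1, Y + D.slack w.1)).2 := by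
    funext Y
    simp [R]
  rw [hR]
  have h' : DifferentiableAt ℝ D.R (w.1, (w.2 - D.slack w.1) + D.slack w.1) := by
    rwa [sub_add_cancel]
  have hin : DifferentiableAt ℝ (fun Y : FrobMat n => (w.1, Y + D.slack w.1))
      (w.2 - D.slack w.1) := by fun_prop
  have hc := DifferentiableAt.comp (w.2 - D.slack w.1) (g := D.R) h' hin
  exact (differentiableAt_id.add_const _).sub hc.snd

theorem hasFDerivAt_R {w : Pair n} {P' : FrobMat n →L[ℝ] FrobMat n}
    (h : HasFDerivAt projPSD P' (w.2 - D.slack w.1)) :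
    HasFDerivAt D.R (D.gradLin.toContinuousLinearMap.prod
      (ContinuousLinearMap.snd ℝ _ _ - P'.comp D.argLin.toContinuousLinearMap)) w := by
  have hg : HasFDerivAt D.gradGamma D.gradLin.toContinuousLinearMap w := by
    rw [(funext D.gradGamma_eq : D.gradGamma = _)]
    exact D.gradLin.toContinuousLinearMap.hasFDerivAt.sub_const _
  have ha : HasFDerivAt (fun w : Pair n => w.2 - D.slack w.1)
      D.argLin.toContinuousLinearMap w := by
    rw [(funext D.snd_sub_slack : (fun w : Pair n => w.2 - D.slack w.1) = _)]
    exact D.argLin.toContinuousLinearMap.hasFDerivAt.sub_const _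
  exact hg.prodMk (hasFDerivAt_snd.sub (HasFDerivAt.comp w (g := projPSD) h ha))

theorem isSymmetric_act_slack (a : EuclideanSpace ℝ (Fin n)) : (act (D.slack a)).IsSymmetric := by
  rw [isSymmetric_act_iff]
  ext ⟨i, j⟩
  rw [transp_apply]
  simp [slack, PhiStar, rankOne, ofMat, Matrix.vecMulVec_apply, Matrix.one_apply, mul_comm,
    eq_comm]

/-- Strong semismoothness of `R` at its roots. -/
theorem exists_norm_R_sub_fderiv_le {x : Pair n} (hx : D.R x = 0) :
    ∃ C : ℝ, 0 ≤ C ∧ ∀ w, DifferentiableAt ℝ D.R w →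
      ‖D.R w - D.R x - fderiv ℝ D.R w (w - x)‖ ≤ C * ‖w - x‖ ^ 2 := by
  have hsym : (act (x.2 - D.slack x.1)).IsSymmetric :=
    isSymmetric_act_sub (posSemidef_toMat_iff.mp (D.mem_domain_of_root hx)).1
      (D.isSymmetric_act_slack x.1)
  obtain ⟨C, hC, h⟩ := exists_norm_projPSD_sub_fderiv_le hsym
  set T := D.argLin.toContinuousLinearMap with hT
  refine ⟨C * ‖T‖ ^ 2, by positivity, fun w hw => ?_⟩
  have hP := (D.differentiableAt_projPSD_of_R hw).hasFDerivAt
  set P' := fderiv ℝ projPSD (w.2 - D.slack w.1)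
  have harg : (w.2 - D.slack w.1) - (x.2 - D.slack x.1) = T (w - x) := by
    rw [snd_sub_slack, snd_sub_slack, sub_sub_sub_cancel_right, ← map_sub]
    rfl
  have key := h _ P' hP
  rw [harg] at key
  rw [(D.hasFDerivAt_R hP).fderiv]
  -- The affine parts of `R` are reproduced exactly, leaving only the linearization error of the
  -- projection.
  have h1 : D.R w - D.R x - (D.gradLin.toContinuousLinearMap.prod
      (ContinuousLinearMap.snd ℝ _ _ - P'.comp T)) (w - x) =
      (0, -(projPSD (w.2 - D.slack w.1) - projPSD (x.2 - D.slack x.1) - P' (T (w - x)))) := by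
    refine Prod.ext ?_ ?_
    · change D.gradGamma w - D.gradGamma x - D.gradLin (w - x) = 0
      rw [gradGamma_sub, sub_self]
    · change (w.2 - projPSD _) - (x.2 - projPSD _) - ((w.2 - x.2) - P' (T (w - x))) =
        -(projPSD _ - projPSD _ - P' (T (w - x)))
      abel
  rw [h1, Prod.norm_mk, norm_zero, norm_neg, max_eq_right (norm_nonneg _)]
  refine key.trans ?_
  rw [mul_assoc, ← mul_pow]
  gcongr
  exact T.le_opNorm _

end Data

/-! ### The local Newton step -/

/-- One inexact regularized Newton step is quadratically convergent when the generalized Jacobian is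
bounded below and satisfies a second-order estimate. -/
theorem norm_newton_step_sub_le {E : Type*} [NormedAddCommGroup E] [NormedSpace ℝ E]
    {J : E →L[ℝ] E} {w Δ x g : E} {m C a₁ a₂ μ : ℝ} (hm : 0 < m) (hJ : ∀ h, m * ‖h‖ ≤ ‖J h‖)
    (hC : ‖g - J (w - x)‖ ≤ C * ‖w - x‖ ^ 2)
    (hN : ‖J Δ + μ • Δ + g‖ ≤ a₁ * ‖w - x‖ * ‖Δ‖) (hμ : |μ| ≤ a₂ * ‖w - x‖)
    (ha : 0 ≤ a₁ + a₂) (hsmall : (a₁ + a₂) * ‖w - x‖ ≤ m / 2) :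
    ‖w + Δ - x‖ ≤ 2 * (C + (a₁ + a₂)) / m * ‖w - x‖ ^ 2 := by
  have h1 : J (w + Δ - x) = (J Δ + μ • Δ + g) - μ • Δ - (g - J (w - x)) := by
    rw [add_sub_right_comm, map_add]
    abel
  have h2 : m * ‖w + Δ - x‖ ≤
      a₁ * ‖w - x‖ * ‖Δ‖ + a₂ * ‖w - x‖ * ‖Δ‖ + C * ‖w - x‖ ^ 2 := by
    refine (hJ _).trans ?_
    rw [h1]
    refine (norm_sub_le _ _).trans (add_le_add ((norm_sub_le _ _).trans (add_le_add hN ?_)) hC)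
    rw [norm_smul]
    exact mul_le_mul_of_nonneg_right hμ (norm_nonneg _)
  have h3 : ‖Δ‖ ≤ ‖w + Δ - x‖ + ‖w - x‖ := by
    have : Δ = (w + Δ - x) - (w - x) := by abel
    nth_rw 1 [this]
    exact norm_sub_le _ _
  have h4 := mul_le_mul_of_nonneg_left h3 (mul_nonneg ha (norm_nonneg (w - x)))
  -- The part of `‖Δ‖` due to the new error is absorbed into half of `m * ‖w + Δ - x‖`, whence the
  -- factor 2 in the bound.
  have h5 := mul_le_mul_of_nonneg_right hsmall (norm_nonneg (w + Δ - x))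
  rw [div_mul_eq_mul_div, le_div_iff₀ hm]
  nlinarith

theorem eventually_mul_lt (c : ℝ) {b : ℝ} (hb : 0 < b) : ∀ᶠ r in 𝓝[>] (0 : ℝ), c * r < b := by
  have h : Tendsto (fun r : ℝ => c * r) (𝓝[>] 0) (𝓝 (c * 0)) :=
    (continuous_const_mul c).continuousAt.tendsto.mono_left nhdsWithin_le_nhds
  exact h.eventually (gt_mem_nhds (by simpa using hb))

/-- The update keeps the regularization parameter bounded unless the middle case occurs. -/
theorem Params.nextTheta_mem (p : Params) {θ ρ s Θ : ℝ} (h0 : 0 ≤ θ) (hθ : θ ≤ Θ)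
    (hlo : p.θlo ≤ Θ) (hhi : p.θhi ≤ Θ) (hs : 0 ≤ s)
    (hρ : p.α₂ * s ≤ ρ ∨ ρ < p.α₁ * s) :
    0 ≤ p.nextTheta θ ρ s ∧ p.nextTheta θ ρ s ≤ Θ := by
  have h2 : 0 ≤ p.β₂ * θ := mul_nonneg (zero_le_one.trans p.β₂_gt.le) h0
  have hβ : p.β₀ * θ ≤ θ := mul_le_of_le_one_left h0 p.β₀_lt.le
  have hα := mul_le_mul_of_nonneg_right p.α₁_le hs
  rw [Params.nextTheta]
  split_ifs with hc1 hc2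
  · exact ⟨p.θlo_pos.le.trans (le_max_left _ _), max_le hlo (hβ.trans hθ)⟩
  · rcases hρ with h | h
    · exact absurd h hc1
    · exact absurd hc2 (not_le.mpr h)
  · exact ⟨le_min p.θhi_pos.le h2, (min_le_left _ _).trans hhi⟩

/-! ### Local estimates at a regular root and the extragradient safeguard. -/

section Convergence

variable {d n N : ℕ} {𝒳 𝒴 : Set (EuclideanSpace ℝ (Fin d))} {HX HY HXY : Type*}
  [NormedAddCommGroup HX] [InnerProductSpace ℝ HX]
  [NormedAddCommGroup HY] [InnerProductSpace ℝ HY]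
  [NormedAddCommGroup HXY] [InnerProductSpace ℝ HXY]

set_option maxHeartbeats 1000000 in
/-- The inexact regularized semismooth Newton step near a regular root of `R`. -/
theorem Data.exists_local_newton_estimates (D : Data d n N 𝒳 𝒴 HX HY HXY) (p : Params)
    {x : Pair n} (hx : D.R x = 0) (hinv : ∀ J ∈ clarkeJacobian D.R x, IsUnit J) {Θ : ℝ}
    (hΘ : 0 ≤ Θ) :
    ∃ r > 0, ∃ C > 0, ∀ w, ‖w - x‖ < r → C * pairNorm (D.R w) ≤ 1 / 2 ∧
      ∀ J ∈ clarkeJacobian D.R w, ∀ θ, 0 ≤ θ → θ ≤ Θ → ∀ Δ : Pair n,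
        pairNorm (J Δ + (θ * pairNorm (D.R w)) • Δ + D.R w)
          ≤ p.τ * min 1 (p.κ * pairNorm (D.R w) * pairNorm Δ) →
        ‖w + Δ - x‖ ≤ ‖w - x‖ ∧ pairNorm (D.R (w + Δ)) ≤ C * pairNorm (D.R w) ^ 2 ∧
          (Δ ≠ 0 → -pairInner (D.R (w + Δ)) Δ < p.α₁ * pairNorm Δ ^ 2) := by
  obtain ⟨K₀, hK₀⟩ := D.exists_lipschitzWith_R
  obtain ⟨δ, hδ, m, hm, hlow⟩ := exists_clarkeJacobian_bounded_below hK₀ x fun J hJ =>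
    (ContinuousLinearMap.isUnit_iff_bijective.mp (hinv J hJ)).injective
  obtain ⟨C₀, hC₀, hsemi⟩ := D.exists_norm_R_sub_fderiv_le hx
  set K : ℝ := (K₀ : ℝ)
  have hK : 0 ≤ K := K₀.coe_nonneg
  have hR : ∀ w, pairNorm (D.R w) ≤ 2 * K * ‖w - x‖ := fun w => by
    have h := hK₀.dist_le_mul w x
    rw [hx, dist_zero_right, dist_eq_norm] at h
    linarith [pairNorm_le (D.R w)]
  set a₁ := 4 * K with ha₁
  set a₂ := 2 * Θ * K with ha₂
  have ha : 0 ≤ a₁ + a₂ := by positivity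
  set B := 2 * (C₀ + (a₁ + a₂)) / m with hB
  have hB0 : 0 ≤ B := by positivity
  -- The residual is at most `2 * K` times the error, and the squared error at most `4 / m ^ 2`
  -- times the squared residual; the `+ 1` ensures positivity.
  set C := 8 * K * B / m ^ 2 + 1 with hC
  have hCpos : 0 < C := by positivity
  -- In order: the lower bound on `J` applies, the Newton cross term is absorbed, the residual
  -- controls the error, the step halves the error, `ρ` falls below `α₁ ‖Δ‖²`, and the residual is
  -- halved.
  obtain ⟨r, ⟨⟨⟨⟨⟨⟨hr1, hr2⟩, hr3⟩, hr4⟩, hr5⟩, hr6⟩, hr0⟩⟩ :=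
    ((((((eventually_mul_lt 1 hδ).and (eventually_mul_lt (a₁ + a₂) (half_pos hm))).and
      (eventually_mul_lt C₀ (half_pos hm))).and (eventually_mul_lt B one_half_pos)).and
      (eventually_mul_lt (4 * K * B) p.α₁_pos)).and
      (eventually_mul_lt (2 * K * C) one_half_pos)).and self_mem_nhdsWithin |>.exists
  refine ⟨r, hr0, C, hCpos, fun w hw => ?_⟩
  set e := ‖w - x‖ with he
  have he0 : 0 ≤ e := norm_nonneg _
  have hmono : ∀ {c b : ℝ}, 0 ≤ c → c * r < b → c * e ≤ b := fun hc hb =>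
    (mul_le_mul_of_nonneg_left hw.le hc).trans hb.le
  refine ⟨?_, fun J hJ θ hθ0 hθ Δ hN => ?_⟩
  · have h1 := hmono (by positivity) hr6
    have h2 := mul_le_mul_of_nonneg_left (hR w) hCpos.le
    linarith
  have hJlow := hlow w (by rw [dist_eq_norm]; linarith) J hJ
  have hJ2 : ‖D.R w - J (w - x)‖ ≤ C₀ * e ^ 2 := by
    simpa [hx] using norm_sub_clarkeJacobian_apply_le hK₀.continuous hsemi w hJ
  have hNΔ : ‖J Δ + (θ * pairNorm (D.R w)) • Δ + D.R w‖ ≤ a₁ * e * ‖Δ‖ := by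
    refine (norm_le_pairNorm _).trans (hN.trans ?_)
    have h0 : 0 ≤ pairNorm (D.R w) * pairNorm Δ :=
      mul_nonneg (pairNorm_nonneg _) (pairNorm_nonneg _)
    calc p.τ * min 1 (p.κ * pairNorm (D.R w) * pairNorm Δ)
        ≤ p.τ * (p.κ * pairNorm (D.R w) * pairNorm Δ) :=
          mul_le_mul_of_nonneg_left (min_le_right _ _) p.τ_pos.le
      _ = (p.τ * p.κ) * (pairNorm (D.R w) * pairNorm Δ) := by ring
      _ ≤ pairNorm (D.R w) * pairNorm Δ :=
          mul_le_of_le_one_left h0 (mul_le_one₀ p.τ_lt.le p.κ_pos.le p.κ_lt.le)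
      _ ≤ (2 * K * e) * (2 * ‖Δ‖) :=
          mul_le_mul (hR w) (pairNorm_le Δ) (pairNorm_nonneg _) (by positivity)
      _ = a₁ * e * ‖Δ‖ := by rw [ha₁]; ring
  have hμ : |θ * pairNorm (D.R w)| ≤ a₂ * e := by
    rw [abs_of_nonneg (mul_nonneg hθ0 (pairNorm_nonneg _))]
    calc θ * pairNorm (D.R w) ≤ Θ * (2 * K * e) :=
          mul_le_mul hθ (hR w) (pairNorm_nonneg _) hΘ
      _ = a₂ * e := by rw [ha₂]; ring
  have hd : ‖w + Δ - x‖ ≤ B * e ^ 2 :=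
    norm_newton_step_sub_le hm hJlow hJ2 hNΔ hμ ha (hmono ha hr2)
  have hBe : B * e ≤ 1 / 2 := hmono hB0 hr4
  have hd2 : ‖w + Δ - x‖ ≤ e / 2 := by nlinarith
  have hRd : pairNorm (D.R (w + Δ)) ≤ 2 * K * (B * e ^ 2) :=
    (hR _).trans (mul_le_mul_of_nonneg_left hd (by positivity))
  refine ⟨by linarith, ?_, fun hΔ => ?_⟩
  -- Local error bound: `J (w - x)` is at least `m * e`, and semismoothness makes its distance to `R
  -- w` at most `m / 2 * e`.
  · have h1 : m / 2 * e ≤ pairNorm (D.R w) := by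
      have h2 := hJlow (w - x)
      have h3 := norm_sub_norm_le (J (w - x)) (D.R w)
      rw [norm_sub_rev] at h3
      have h4 : C₀ * e ≤ m / 2 := hmono hC₀ hr3
      have h5 := norm_le_pairNorm (D.R w)
      nlinarith
    have h2 : e ^ 2 ≤ 4 / m ^ 2 * pairNorm (D.R w) ^ 2 := by
      have h3 := pow_le_pow_left₀ (by positivity) h1 2
      rw [div_mul_eq_mul_div, le_div_iff₀ (by positivity)]
      nlinarith
    calc pairNorm (D.R (w + Δ)) ≤ 2 * K * (B * e ^ 2) := hRd
      _ ≤ 2 * K * (B * (4 / m ^ 2 * pairNorm (D.R w) ^ 2)) := by gcongr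
      _ = 8 * K * B / m ^ 2 * pairNorm (D.R w) ^ 2 := by ring
      _ ≤ C * pairNorm (D.R w) ^ 2 := by
        refine mul_le_mul_of_nonneg_right ?_ (sq_nonneg _)
        rw [hC]
        linarith
  · have hΔpos : 0 < pairNorm Δ := (norm_pos_iff.mpr hΔ).trans_le (norm_le_pairNorm Δ)
    -- As the step at least halves the error, `Δ` has length at least `e / 2`; the new residual, of
    -- order `e ^ 2`, is thus of order `e * ‖Δ‖`.
    have h1 : e ≤ 2 * pairNorm Δ := by
      have h2 : e ≤ ‖w + Δ - x‖ + ‖Δ‖ := by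
        have h3 := norm_sub_le (w + Δ - x) Δ
        have h4 : w + Δ - x - Δ = w - x := by abel
        rwa [h4] at h3
      linarith [norm_le_pairNorm Δ]
    have h2 : 4 * K * B * e < p.α₁ :=
      (mul_le_mul_of_nonneg_left hw.le (by positivity)).trans_lt hr5
    calc -pairInner (D.R (w + Δ)) Δ ≤ pairNorm (D.R (w + Δ)) * pairNorm Δ :=
          (neg_le_abs _).trans (abs_pairInner_le _ _)
      _ ≤ 2 * K * (B * e ^ 2) * pairNorm Δ := mul_le_mul_of_nonneg_right hRd hΔpos.le
      _ = 2 * K * B * e * pairNorm Δ * e := by ring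
      _ ≤ 2 * K * B * e * pairNorm Δ * (2 * pairNorm Δ) :=
          mul_le_mul_of_nonneg_left h1 (by positivity)
      _ = 4 * K * B * e * pairNorm Δ ^ 2 := by ring
      _ < p.α₁ * pairNorm Δ ^ 2 := mul_lt_mul_of_pos_right h2 (by positivity)

/-- The extragradient iterates stay at least as close to a root of `R` as the initial point. -/
theorem IsRun.pairEuclNorm_extragradient_sub_le {D : Data d n N 𝒳 𝒴 HX HY HXY} {p : Params}
    {η : ℝ} {w v Δ : ℕ → Pair n} {J : ℕ → Pair n →L[ℝ] Pair n} {θ : ℕ → ℝ}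
    (h : IsRun D p η w v Δ J θ) (hη : D.IsEGStepSize η) {x : Pair n} (hx : D.R x = 0) (k : ℕ) :
    v k ∈ domain n ∧ pairEuclNorm (v k - x) ≤ pairEuclNorm (w 0 - x) := by
  induction k with
  | zero => rw [h.init_v]; exact ⟨h.init_mem, le_rfl⟩
  | succ k ih =>
    rw [h.step_v]
    exact ⟨D.egStep_mem_domain η _, (D.pairEuclNorm_egStep_sub_le hη hx ih.1).trans ih.2⟩

end Convergence

end KernelOT

end

theorem theorem2 {d n N : ℕ} {𝒳 𝒴 : Set (EuclideanSpace ℝ (Fin d))} {HX HY HXY : Type*}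
    [NormedAddCommGroup HX] [InnerProductSpace ℝ HX]
    [NormedAddCommGroup HY] [InnerProductSpace ℝ HY]
    [NormedAddCommGroup HXY] [InnerProductSpace ℝ HXY]
    (D : KernelOT.Data d n N 𝒳 𝒴 HX HY HXY) (p : KernelOT.Params)
    (η : ℝ) (hη : D.IsEGStepSize η)
    (wstar : KernelOT.Pair n) (hroot : D.R wstar = 0)
    (hinv : ∀ J ∈ KernelOT.clarkeJacobian D.R wstar, IsUnit J) :
    ∃ ε : ℝ, 0 < ε ∧ ∃ C : ℝ, 0 < C ∧
      ∀ w : ℕ → KernelOT.Pair n, KernelOT.GeneratedBy D p η w →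
        KernelOT.pairNorm (w 0 - wstar) < ε →
        (∀ k, KernelOT.pairNorm (D.R (w (k + 1))) ≤ C * KernelOT.pairNorm (D.R (w k)) ^ 2) ∧
        Tendsto (fun k => KernelOT.pairNorm (D.R (w k))) atTop (𝓝 0) := by
  obtain ⟨r, hr, C, hC, hloc⟩ := D.exists_local_newton_estimates p hroot hinv
    (Θ := max p.θinit (max p.θlo p.θhi)) (p.θinit_pos.le.trans (le_max_left _ _))
  -- The two outer branches of the update never exceed this value once `θ` is below it.
  set Θ := max p.θinit (max p.θlo p.θhi) with hΘ
  refine ⟨r, hr, C, hC, fun w ⟨v, Δ, J, θ, hrun⟩ hw0 => ?_⟩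
  -- The Euclidean norm, in which the distance does not increase, lies between the maximum norm and
  -- `pairNorm`, so the same radius `r` serves.
  have hvr : ∀ k, ‖v k - wstar‖ < r := fun k =>
    ((KernelOT.norm_le_pairEuclNorm _).trans
      ((hrun.pairEuclNorm_extragradient_sub_le hη hroot k).2.trans
        (KernelOT.pairEuclNorm_le_pairNorm _))).trans_lt hw0
  have hinvt : ∀ k, ‖w k - wstar‖ < r ∧ 0 ≤ θ k ∧ θ k ≤ Θ := by
    intro k
    induction k with
    | zero =>
      rw [hrun.init_θ]
      exact ⟨(KernelOT.norm_le_pairNorm _).trans_lt hw0, p.θinit_pos.le, le_max_left _ _⟩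
    | succ k ih =>
      obtain ⟨h1, -, h3⟩ := (hloc (w k) ih.1).2 (J k) (hrun.jac_mem k) (θ k) ih.2.1 ih.2.2 (Δ k)
        (hrun.newton k)
      refine ⟨?_, ?_⟩
      · rcases le_or_gt (KernelOT.pairNorm (D.R (w k + Δ k)))
          (KernelOT.pairNorm (D.R (v (k + 1)))) with h | h
        · rw [hrun.accept k h]
          exact h1.trans_lt ih.1
        · rw [hrun.safeguard k h]
          exact hvr (k + 1)
      · rw [hrun.step_θ]
        refine p.nextTheta_mem ih.2.1 ih.2.2 ((le_max_left _ _).trans (le_max_right _ _))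
          ((le_max_right _ _).trans (le_max_right _ _)) (sq_nonneg _) ?_
        -- For a zero step both sides of the first test vanish, so the first branch applies.
        rcases eq_or_ne (Δ k) 0 with h0 | h0
        · left
          simp [h0, KernelOT.pairNorm, KernelOT.pairInner]
        · exact Or.inr (h3 h0)
  have hquad : ∀ k, KernelOT.pairNorm (D.R (w (k + 1))) ≤ C * KernelOT.pairNorm (D.R (w k)) ^ 2 := by
    intro k
    obtain ⟨h0, hθ0, hθ⟩ := hinvt k
    obtain ⟨-, h2, -⟩ := (hloc (w k) h0).2 (J k) (hrun.jac_mem k) (θ k) hθ0 hθ (Δ k) (hrun.newton k)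
    rcases le_or_gt (KernelOT.pairNorm (D.R (w k + Δ k)))
      (KernelOT.pairNorm (D.R (v (k + 1)))) with h | h
    · rwa [hrun.accept k h]
    · rw [hrun.safeguard k h]
      -- The safeguard point has smaller residual than the Newton trial point and inherits its
      -- bound.
      exact h.le.trans h2
  refine ⟨hquad, ?_⟩
  have hgeom : ∀ k, KernelOT.pairNorm (D.R (w k)) ≤ (1 / 2) ^ k * KernelOT.pairNorm (D.R (w 0)) := by
    intro k
    induction k with
    | zero => simp
    | succ k ih =>
      calc _ ≤ C * KernelOT.pairNorm (D.R (w k)) * KernelOT.pairNorm (D.R (w k)) := by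
            rw [mul_assoc, ← sq]
            exact hquad k
        _ ≤ 1 / 2 * KernelOT.pairNorm (D.R (w k)) :=
            mul_le_mul_of_nonneg_right (hloc (w k) (hinvt k).1).1 (KernelOT.pairNorm_nonneg _)
        _ ≤ 1 / 2 * ((1 / 2) ^ k * KernelOT.pairNorm (D.R (w 0))) :=
            mul_le_mul_of_nonneg_left ih (by norm_num)
        _ = _ := by ring
  refine squeeze_zero (fun k => KernelOT.pairNorm_nonneg _) hgeom ?_
  simpa using (tendsto_pow_atTop_nhds_zero_of_lt_one (r := (1 / 2 : ℝ)) (by norm_num)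
    (by norm_num)).mul_const (KernelOT.pairNorm (D.R (w 0)))
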